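/- Let $\mathcal D(I)$ denote the set of all dyadic subintervals of a bounded interval $I$ (including $I$ itself), $J^\pm$ the two halves of $J$, $\langle w\rangle_J=\frac1{|J|}\int_J w$ and $\Delta_J w=\langle w\rangle_{J^-}-\langle w\rangle_{J^+}$. Let $Q\ge 1$, $L=\sqrt Q$, and let $\Phi$ be a non-negative function on $[1,\infty)$; put $f(s)=\Phi(s^2)$ and $h(s)=f(s)/s^2$ for $s\ge1$. For a function $w$ on $I$ that is positive almost everywhere, with $w$ and $w^{-1}$ integrable on $I$, let $$c_J^\Phi(w)=|J|\,\Phi\big(\langle w\rangle_J\langle w^{-1}\rangle_J\big)\left[\frac{(\Delta_J w)^2}{\langle w\rangle_J^2}+\frac{(\Delta_J w^{-1})^2}{\langle w^{-1}\rangle_J^2}\right],\qquad J\in\mathcal D(I).$$ For $x_1,x_2>0$ with $1\le x_1x_2\le Q$, let $E_{Q,x,I}$ be the set of such $w$ with $\sup_{J\in\mathcal D(I)}\langle w\rangle_J\langle w^{-1}\rangle_J\le Q$, $\langle w\rangle_I=x_1$ and $\langle w^{-1}\rangle_I=x_2$, and define the upper Bellman function $$\mathbf B_{Q,\Phi}(x_1,x_2)=\sup\Big\{\frac1{|I|}\sum_{J\in\mathcal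 D(I)}c_J^\Phi(w):\ w\in E_{Q,x,I}\Big\}.$$ Let also $$A_{L,f}(s)=16\left[\frac{f(L)}L+\int_1^L\frac{f(z)}{z^2}\,dz\right](s-1)-16\int_1^s\frac{f(z)}{z^2}(s-z)\,dz,\qquad a_f(s)=16\int_1^s\frac{f(z)}z\,dz.$$ **Theorem.** For every $Q\ge1$, every bounded nondegenerate interval $I$ and all $x_1,x_2>0$ with $1\le x_1x_2\le Q$, the set $E_{Q,x,I}$ is nonempty, and, with $s=\sqrt{x_1x_2}$ (monotonicity being understood in the non-strict sense): 1. If $\Phi$ is increasing and $h$ is convex on $[1,\infty)$, then the integrals defining $A_{L,f}(s)$ converge absolutely and $\mathbf B_{Q,\Phi}(x_1,x_2)=A_{L,f}(s)$. 2. If $\Phi$ is increasing and $h$ is concave on $[1,\infty)$, then $$\mathbf B_{Q,\Phi}(x_1,x_2)\le 8(s-1)(4L-s-1)\,h(s_0(s)),\qquad\text{where } s_0(s)=\frac{9L^2-s^2-s-1}{3(4L-s-1)}.$$ 3. If $\Phi$ is decreasing on $[1,\infty)$, then the integral defining $a_f(s)$ converges absolutely and $\mathbf B_{Q,\Phi}(x_1,x_2)=a_f(s)$.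 -/

import Mathlib

noncomputable section

namespace DyadicBellman

/-- A bounded nondegenerate interval of the line, given by its endpoints. -/
structure Ivl where
  left : ℝ
  right : ℝ
  lt : left < right

/-- The length `|I|`. -/
def Ivl.len (I : Ivl) : ℝ := I.right - I.left

/-- The left half `I⁻`. -/
def Ivl.leftHalf (I : Ivl) : Ivl where
  left := I.left
  right := (I.left + I.right) / 2
  lt := by linarith [I.lt]

/-- The right half `I⁺`. -/
def Ivl.rightHalf (I : Ivl) : Ivl where
  left := (I.left + I.right) / 2
  right := I.right
  lt := by linarith [I.lt]

/-- The `k`-th interval, counted from the left, of length `2⁻ⁿ |I|`. The `n`-th generation `𝒟ₙ(I)` of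
dyadic subintervals of `I` consists of `I.sub n k` for `0 ≤ k < 2ⁿ`, and `𝒟(I)` is the union
of all generations. -/
def Ivl.sub (I : Ivl) (n k : ℕ) : Ivl where
  left := I.left + (k : ℝ) * (I.len / 2 ^ n)
  right := I.left + ((k : ℝ) + 1) * (I.len / 2 ^ n)
  lt := by
    have h : 0 < I.len / 2 ^ n := div_pos (sub_pos.mpr I.lt) (by positivity)
    nlinarith

/-- The average of `w` over `J`. -/
def avg (w : ℝ → ℝ) (J : Ivl) : ℝ := J.len⁻¹ * ∫ x in J.left..J.right, w x

/-- The pointwise reciprocal weight. -/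
def recip (w : ℝ → ℝ) : ℝ → ℝ := fun x => (w x)⁻¹

/-- `Δ_J w`, the difference of the averages over the two halves of `J`. -/
def delta (w : ℝ → ℝ) (J : Ivl) : ℝ := avg w J.leftHalf - avg w J.rightHalf

/-- `R_J(w)`. -/
def R (w : ℝ → ℝ) (J : Ivl) : ℝ :=
  delta w J ^ 2 / avg w J ^ 2 + delta (recip w) J ^ 2 / avg (recip w) J ^ 2

/-- `c_J^Φ(w)`. -/
def c (Φ : ℝ → ℝ) (w : ℝ → ℝ) (J : Ivl) : ℝ :=
  J.len * Φ (avg w J * avg (recip w) J) * R w J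

/-- `w` is integrable and almost everywhere positive on `I`. -/
structure IsWeightOn (w : ℝ → ℝ) (I : Ivl) : Prop where
  integrable : IntervalIntegrable w MeasureTheory.volume I.left I.right
  pos : ∀ᵐ x, x ∈ Set.Icc I.left I.right → 0 < w x

/-- The dyadic `A₂`-characteristic on `I`: the supremum over all dyadic subintervals of `I` of the
product of the averages of `w` and of its reciprocal (for `w` and its reciprocal integrable
on `I`). -/
def a2Char (w : ℝ → ℝ) (I : Ivl) : ENNReal :=
  ⨆ (n : ℕ) (k : ℕ) (_ : k < 2 ^ n),
    ENNReal.ofReal (avg w (I.sub n k) * avg (recip w) (I.sub n k))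

/-- The class of dyadic `A₂` weights on `I` with characteristic at most `Q`. -/
def A2 (Q : ℝ) (I : Ivl) : Set (ℝ → ℝ) :=
  {w | IsWeightOn w I ∧ IsWeightOn (recip w) I ∧ a2Char w I ≤ ENNReal.ofReal Q}

/-- The domain `Ω_Q` (in the open first quadrant, where averages of weights lie). -/
def Omega (Q : ℝ) : Set (ℝ × ℝ) :=
  {x | 0 < x.1 ∧ 0 < x.2 ∧ 1 ≤ x.1 * x.2 ∧ x.1 * x.2 ≤ Q}

/-- The class `E_{Q,x,I}` of admissible weights. -/
def E (Q : ℝ) (x : ℝ × ℝ) (I : Ivl) : Set (ℝ → ℝ) :=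
  {w | w ∈ A2 Q I ∧ avg w I = x.1 ∧ avg (recip w) I = x.2}

/-- `|I|⁻¹ ∑_{J ∈ 𝒟(I)} c_J^Φ(w)`, a sum of non-negative terms with values in `[0, ∞]`. -/
def dyadicSum (Φ : ℝ → ℝ) (w : ℝ → ℝ) (I : Ivl) : ENNReal :=
  (ENNReal.ofReal I.len)⁻¹ *
    ∑' n : ℕ, ∑ k ∈ Finset.range (2 ^ n), ENNReal.ofReal (c Φ w (I.sub n k))

/-- The upper Bellman function, computed on the interval `I`. The supremum is taken in the extended
reals, so that it is `⊥` if there is no admissible weight and `⊤` if it is infinite. -/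
def upperBellman (Q : ℝ) (Φ : ℝ → ℝ) (I : Ivl) (x : ℝ × ℝ) : EReal :=
  ⨆ w ∈ E Q x I, (dyadicSum Φ w I : EReal)

/-- `f(s) = Φ(s²)`. -/
def fOf (Φ : ℝ → ℝ) (s : ℝ) : ℝ := Φ (s ^ 2)

/-- `h(s) = f(s) / s²`. -/
def hOf (Φ : ℝ → ℝ) (s : ℝ) : ℝ := fOf Φ s / s ^ 2

/-- The candidate `A_{L,f}`. -/
def candA (L : ℝ) (f : ℝ → ℝ) (s : ℝ) : ℝ :=
  16 * (f L / L + ∫ z in (1 : ℝ)..L, f z / z ^ 2) * (s - 1)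
    - 16 * ∫ z in (1 : ℝ)..s, f z / z ^ 2 * (s - z)

/-- The candidate `a_f`. -/
def canda (f : ℝ → ℝ) (s : ℝ) : ℝ := 16 * ∫ z in (1 : ℝ)..s, f z / z

/-- The point `s₀(s)` at which `h` is evaluated in the concave case. -/
def s0 (L s : ℝ) : ℝ := (9 * L ^ 2 - s ^ 2 - s - 1) / (3 * (4 * L - s - 1))

end DyadicBellman

end

namespace DyadicBellman

section

open MeasureTheory Set

/-! ### Elementary convexity and integration facts -/

/-! The problem reduces to one variable. Let `s`, `a`, `b` be the square roots of the products of
averages of `w` and its reciprocal on an interval and on its two halves. By `R_le`, a + b ≤ 2s and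
the relative jumps cost at most 8(1 - ab/s²). Hence every non-negative `G` on [1, L] with 8f(s)(1 -
ab/s²) + (G(a) + G(b))/2 ≤ G(s) bounds the dyadic sum, by induction on generations
(`dyadicSum_le_of_supersolution`).

For decreasing `Φ`, `canda` is such a `G`, by log x ≥ 1 - 1/x (`canda_supersolution`). For
increasing `Φ` and convex `h` it is the solution of A'' = -16h, A(1) = 0, A'(L) = 16 L h(L)
(`profile_supersolution`). For concave `h`, the latter is applied to an affine majorant of `h`. The
profile at `s` is the integral of `h` against a positive measure with mass 8(s - 1)(4L - s - 1) and
barycentre s₀(s), so touching `h` at s₀(s) makes the slope of the majorant drop out.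

The lower bounds glue weights on halves. Scaling the averages by 1 ± α and 1 ± β with |α| = |β|
turns the bound on the jumps into an equality. Opposite signs send both halves to a smaller `t`
(`attainable_down`); equal signs send them to s ± d (`attainable_mid`). Small downward steps build
up the integral `canda`. In the convex case, a downward step at `L` yields the boundary slope 16
f(L)/L, and symmetric steps then reproduce A'' = -16h as a difference inequality from `L` down to 1.
-/

lemma exists_supporting_slope {h : ℝ → ℝ} (hh : ConvexOn ℝ (Ici 1) h) {s : ℝ} (hs : 1 < s) :
    ∃ p : ℝ, ∀ z, 1 ≤ z → h s + p * (z - s) ≤ h z := by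
  have hi : s ∈ interior (Ici (1 : ℝ)) := by simpa using hs
  refine ⟨derivWithin h (Ioi s) s, fun z hz => ?_⟩
  rcases lt_trichotomy z s with hzs | rfl | hzs
  · have h1 := hh.slope_le_leftDeriv_of_mem_interior (x := z) hz hi hzs
    have h2 := hh.leftDeriv_le_rightDeriv_of_mem_interior hi
    have h3 := h1.trans h2
    rw [slope_def_field, div_le_iff₀ (sub_pos.mpr hzs)] at h3
    nlinarith
  · simp
  · have h1 := hh.rightDeriv_le_slope_of_mem_interior hi (y := z) hz hzs
    rw [slope_def_field, le_div_iff₀ (sub_pos.mpr hzs)] at h1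
    linarith

lemma intervalIntegrable_of_mem {h : ℝ → ℝ} {L : ℝ} (hi : IntervalIntegrable h volume 1 L)
    {u v : ℝ} (hu : u ∈ Icc 1 L) (hv : v ∈ Icc 1 L) : IntervalIntegrable h volume u v := by
  have hL : 1 ≤ L := hu.1.trans hu.2
  refine hi.mono_set ?_
  rw [uIcc_of_le hL]
  exact uIcc_subset_Icc hu hv

lemma integral_sub_eq {h : ℝ → ℝ} {L : ℝ} (hi : IntervalIntegrable h volume 1 L)
    {u v : ℝ} (hu : u ∈ Icc 1 L) (hv : v ∈ Icc 1 L) :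
    ∫ z in u..v, h z = (∫ z in (1 : ℝ)..v, h z) - ∫ z in (1 : ℝ)..u, h z := by
  have h1 : (1 : ℝ) ∈ Icc 1 L := ⟨le_rfl, hu.1.trans hu.2⟩
  rw [intervalIntegral.integral_interval_sub_left (intervalIntegrable_of_mem hi h1 hv)
    (intervalIntegrable_of_mem hi h1 hu)]

lemma integral_mul_sub_eq {h : ℝ → ℝ} {L : ℝ} (hi : IntervalIntegrable h volume 1 L)
    {u v : ℝ} (hu : u ∈ Icc 1 L) (hv : v ∈ Icc 1 L) (c : ℝ) :
    ∫ z in u..v, h z * (z - c) =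
      ((∫ z in (1 : ℝ)..v, h z * z) - ∫ z in (1 : ℝ)..u, h z * z)
        - c * ((∫ z in (1 : ℝ)..v, h z) - ∫ z in (1 : ℝ)..u, h z) := by
  have hz : IntervalIntegrable (fun z => h z * z) volume 1 L :=
    hi.mul_continuousOn continuousOn_id
  rw [← integral_sub_eq hi hu hv, ← integral_sub_eq hz hu hv,
    ← intervalIntegral.integral_const_mul, ← intervalIntegral.integral_sub
      (intervalIntegrable_of_mem hz hu hv) ((intervalIntegrable_of_mem hi hu hv).const_mul c)]
  congr 1
  ext z
  ring

lemma integral_affine (u v c p q : ℝ) :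
    ∫ z in u..v, (c + p * (z - q)) = c * (v - u) + p * ((v ^ 2 - u ^ 2) / 2 - q * (v - u)) := by
  have hd : ∀ z ∈ uIcc u v, HasDerivAt (fun z : ℝ => c * z + p * (z ^ 2 / 2 - q * z))
      (c + p * (z - q)) z := by
    intro z _
    have h := ((hasDerivAt_id z).const_mul c).add
      (((((hasDerivAt_id z).pow 2).div_const 2).sub ((hasDerivAt_id z).const_mul q)).const_mul p)
    refine h.congr_deriv ?_
    simp
  rw [intervalIntegral.integral_eq_sub_of_hasDerivAt hd
    (Continuous.intervalIntegrable (by fun_prop) _ _)]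
  ring

lemma integral_affine_mul (u v c p q a : ℝ) :
    ∫ z in u..v, (c + p * (z - q)) * (z - a) =
      (c - p * q) * ((v - a) ^ 2 / 2 - (u - a) ^ 2 / 2)
        + p * ((v ^ 3 - u ^ 3) / 3 - a * (v ^ 2 - u ^ 2) / 2) := by
  have hd : ∀ z ∈ uIcc u v, HasDerivAt
      (fun z : ℝ => (c - p * q) * ((z - a) ^ 2 / 2) + p * (z ^ 3 / 3 - a * z ^ 2 / 2))
      ((c + p * (z - q)) * (z - a)) z := by
    intro z _
    have h := (((((hasDerivAt_id z).sub_const a).pow 2).div_const 2).const_mul (c - p * q)).add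
      (((((hasDerivAt_id z).pow 3).div_const 3).sub
        ((((hasDerivAt_id z).pow 2).const_mul a).div_const 2)).const_mul p)
    refine h.congr_deriv ?_
    simp
    ring
  rw [intervalIntegral.integral_eq_sub_of_hasDerivAt hd
    (Continuous.intervalIntegrable (by fun_prop) _ _)]
  ring

/-- The kernel `z - a` is non-negative on the interval, so any affine minorant of `h` can be
integrated. It is used with a supporting line and also with the zero minorant, which gives bare
positivity. -/
lemma affine_moment_le {h : ℝ → ℝ} {L : ℝ} (hi : IntervalIntegrable h volume 1 L) {c p q : ℝ}
    (hl : ∀ z, 1 ≤ z → c + p * (z - q) ≤ h z)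
    {u v : ℝ} (hu : u ∈ Icc 1 L) (hv : v ∈ Icc 1 L) (huv : u ≤ v) {a : ℝ} (hau : a ≤ u) :
    (c - p * q) * ((v - a) ^ 2 / 2 - (u - a) ^ 2 / 2)
        + p * ((v ^ 3 - u ^ 3) / 3 - a * (v ^ 2 - u ^ 2) / 2) ≤ ∫ z in u..v, h z * (z - a) := by
  rw [← integral_affine_mul]
  refine intervalIntegral.integral_mono_on huv (Continuous.intervalIntegrable (by fun_prop) _ _)
    ((intervalIntegrable_of_mem hi hu hv).mul_continuousOn (by fun_prop)) fun z hz => ?_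
  exact mul_le_mul_of_nonneg_right (hl z (hu.1.trans hz.1)) (by linarith [hz.1])

lemma integral_mul_sub_le_affine {h : ℝ → ℝ} {L : ℝ} (hi : IntervalIntegrable h volume 1 L)
    {c p q : ℝ} (hl : ∀ z, 1 ≤ z → c + p * (z - q) ≤ h z)
    {u v : ℝ} (hu : u ∈ Icc 1 L) (hv : v ∈ Icc 1 L) (huv : u ≤ v) {a : ℝ} (hau : v ≤ a) :
    ∫ z in u..v, h z * (z - a) ≤ (c - p * q) * ((v - a) ^ 2 / 2 - (u - a) ^ 2 / 2)
        + p * ((v ^ 3 - u ^ 3) / 3 - a * (v ^ 2 - u ^ 2) / 2) := by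
  rw [← integral_affine_mul]
  refine intervalIntegral.integral_mono_on huv
    ((intervalIntegrable_of_mem hi hu hv).mul_continuousOn (by fun_prop))
    (Continuous.intervalIntegrable (by fun_prop) _ _) fun z hz => ?_
  exact mul_le_mul_of_nonpos_right (hl z (hu.1.trans hz.1)) (by linarith [hz.2])

lemma integral_inv_sq {s L : ℝ} (hs : 1 ≤ s) (hsL : s ≤ L) :
    ∫ z in s..L, (z ^ 2)⁻¹ = s⁻¹ - L⁻¹ := by
  have hd : ∀ z ∈ uIcc s L, HasDerivAt (fun z : ℝ => -z⁻¹) ((z ^ 2)⁻¹) z := by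
    intro z hz
    rw [uIcc_of_le hsL] at hz
    have hz0 : z ≠ 0 := by linarith [hz.1]
    exact (hasDerivAt_inv hz0).fun_neg.congr_deriv (neg_neg _)
  rw [intervalIntegral.integral_eq_sub_of_hasDerivAt hd]
  · ring
  · refine ContinuousOn.intervalIntegrable (ContinuousOn.inv₀ (by fun_prop) fun z hz => ?_)
    rw [uIcc_of_le hsL] at hz
    have : 0 < z := by linarith [hz.1]
    positivity

/-! ### The candidate in the convex case -/

/-- The solution of `A'' = -16 h` on `[1, L]` with `A(1) = 0` and `A'(L) = 16 L h(L)`. -/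
noncomputable def profile (L : ℝ) (h : ℝ → ℝ) (s : ℝ) : ℝ :=
  16 * (L * h L + ∫ z in (1 : ℝ)..L, h z) * (s - 1) - 16 * ∫ z in (1 : ℝ)..s, h z * (s - z)

/-- The derivative of the profile. -/
noncomputable def profileSlope (L : ℝ) (h : ℝ → ℝ) (s : ℝ) : ℝ := 16 * (L * h L + ∫ z in s..L, h z)

lemma profile_eq {h : ℝ → ℝ} {L : ℝ} (hi : IntervalIntegrable h volume 1 L)
    {s : ℝ} (hs : s ∈ Icc 1 L) :
    profile L h s = 16 * (L * h L + ∫ z in (1 : ℝ)..L, h z) * (s - 1)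
      - 16 * (s * (∫ z in (1 : ℝ)..s, h z) - ∫ z in (1 : ℝ)..s, h z * z) := by
  have h1 : (1 : ℝ) ∈ Icc 1 L := ⟨le_rfl, hs.1.trans hs.2⟩
  have := integral_mul_sub_eq hi h1 hs s
  simp only [intervalIntegral.integral_same, sub_zero] at this
  have h2 : ∫ z in (1 : ℝ)..s, h z * (s - z) = - ∫ z in (1 : ℝ)..s, h z * (z - s) := by
    rw [← intervalIntegral.integral_neg]
    congr 1
    ext z
    ring
  rw [profile, h2, this]
  ring

/-- Taylor's formula at `s` with integral remainder, obtained by comparing moments of `h`, so that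
nothing beyond integrability is needed. -/
lemma profile_sub {h : ℝ → ℝ} {L : ℝ} (hi : IntervalIntegrable h volume 1 L)
    {s t : ℝ} (hs : s ∈ Icc 1 L) (ht : t ∈ Icc 1 L) :
    profile L h t - profile L h s =
      (t - s) * profileSlope L h s + 16 * ∫ z in s..t, h z * (z - t) := by
  have hL : L ∈ Icc 1 L := ⟨hs.1.trans hs.2, le_rfl⟩
  rw [profile_eq hi hs, profile_eq hi ht, profileSlope, integral_sub_eq hi hs hL,
    integral_mul_sub_eq hi hs ht]
  ring

lemma profile_sub_le {h : ℝ → ℝ} {L : ℝ} (hi : IntervalIntegrable h volume 1 L)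
    (h0 : ∀ z, 1 ≤ z → 0 ≤ h z)
    {s t : ℝ} (hs : s ∈ Icc 1 L) (ht : t ∈ Icc 1 L) (hst : s ≤ t) :
    profile L h t - profile L h s ≤ (t - s) * profileSlope L h s := by
  have := integral_mul_sub_le_affine hi (c := 0) (p := 0) (q := 0) (by simpa using h0) hs ht hst
    (le_refl t)
  rw [profile_sub hi hs ht]
  linarith

lemma profileSlope_nonneg {h : ℝ → ℝ} {L : ℝ} (h0 : ∀ z, 1 ≤ z → 0 ≤ h z)
    {s : ℝ} (hs : s ∈ Icc 1 L) : 0 ≤ profileSlope L h s := by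
  have h1 : 0 ≤ ∫ z in s..L, h z :=
    intervalIntegral.integral_nonneg hs.2 fun z hz => h0 z (hs.1.trans hz.1)
  have h2 := h0 L (hs.1.trans hs.2)
  have h3 : 0 ≤ L := by linarith [hs.1, hs.2]
  rw [profileSlope]
  positivity

lemma profile_one (L : ℝ) (h : ℝ → ℝ) : profile L h 1 = 0 := by simp [profile]

lemma profile_nonneg {h : ℝ → ℝ} {L : ℝ} (hi : IntervalIntegrable h volume 1 L)
    (h0 : ∀ z, 1 ≤ z → 0 ≤ h z) {s : ℝ} (hs : s ∈ Icc 1 L) : 0 ≤ profile L h s := by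
  have h1 : (1 : ℝ) ∈ Icc 1 L := ⟨le_rfl, hs.1.trans hs.2⟩
  have h2 := profile_sub hi hs h1
  have h3 := affine_moment_le hi (c := 0) (p := 0) (q := 0) (by simpa using h0) h1 hs hs.1
    (le_refl 1)
  rw [profile_one, intervalIntegral.integral_symm] at h2
  nlinarith [profileSlope_nonneg h0 hs, hs.1]

/-- The midpoint defect of the profile, as a combination of integrals with non-negative kernels. -/
lemma profile_midpoint_defect {h : ℝ → ℝ} {L : ℝ} (hi : IntervalIntegrable h volume 1 L)
    {s a b M : ℝ} (hs : s ∈ Icc 1 L) (ha : a ∈ Icc 1 L) (hb : b ∈ Icc 1 L)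
    (hM : M = (a + b) / 2) :
    profile L h s - (profile L h a + profile L h b) / 2 =
      (s - M) * profileSlope L h s + 16 * (∫ z in M..s, h z * (z - M))
        + 8 * ((∫ z in b..M, h z * (z - b)) - ∫ z in M..a, h z * (z - a)) := by
  have hL : L ∈ Icc 1 L := ⟨hs.1.trans hs.2, le_rfl⟩
  have hMm : M ∈ Icc 1 L := ⟨by linarith [ha.1, hb.1], by linarith [ha.2, hb.2]⟩
  rw [profile_eq hi hs, profile_eq hi ha, profile_eq hi hb, profileSlope,
    integral_sub_eq hi hs hL, integral_mul_sub_eq hi hMm hs, integral_mul_sub_eq hi hb hMm,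
    integral_mul_sub_eq hi hMm ha]
  subst hM
  ring

/-- Monotonicity of z²h(z) gives h(z) ≥ s²h(s)/z² beyond `s`. The integral then contributes
s²h(s)(1/s - 1/L), and the boundary term L h(L) makes up for the missing s²h(s)/L. -/
lemma profileSlope_ge_of_monotoneOn {h : ℝ → ℝ} {L : ℝ} (hi : IntervalIntegrable h volume 1 L)
    (hm : MonotoneOn (fun z => z ^ 2 * h z) (Ici 1)) {s : ℝ} (hs : s ∈ Icc 1 L) :
    16 * (h s * s) ≤ profileSlope L h s := by
  have hs0 : 0 < s := by linarith [hs.1]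
  have hL0 : 0 < L := by linarith [hs.2]
  have hL : L ∈ Icc 1 L := ⟨hs.1.trans hs.2, le_rfl⟩
  have h1 : ∫ z in s..L, (h s * s ^ 2) * (z ^ 2)⁻¹ ≤ ∫ z in s..L, h z := by
    refine intervalIntegral.integral_mono_on hs.2 ?_ (intervalIntegrable_of_mem hi hs hL) ?_
    · refine ContinuousOn.intervalIntegrable (ContinuousOn.mul (by fun_prop)
        (ContinuousOn.inv₀ (by fun_prop) fun z hz => ?_))
      rw [uIcc_of_le hs.2] at hz
      have : 0 < z := by linarith [hz.1]
      positivity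
    · intro z hz
      have hz0 : 0 < z := by linarith [hz.1]
      have := hm hs.1 (hs.1.trans hz.1) hz.1
      simp only at this
      rw [← div_eq_mul_inv, div_le_iff₀ (by positivity)]
      linarith
  rw [intervalIntegral.integral_const_mul, integral_inv_sq hs.1 hs.2] at h1
  have h2 : h s * s ^ 2 * L⁻¹ ≤ L * h L := by
    have := hm hs.1 hL.1 hs.2
    simp only at this
    rw [← div_eq_mul_inv, div_le_iff₀ hL0]
    linarith
  have h3 : h s * s ^ 2 * (s⁻¹ - L⁻¹) = h s * s - h s * s ^ 2 * L⁻¹ := by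
    field_simp
  rw [profileSlope]
  linarith

lemma profileSlope_ge_affine {h : ℝ → ℝ} {L : ℝ} (hi : IntervalIntegrable h volume 1 L)
    {s p : ℝ} (hl : ∀ z, 1 ≤ z → h s + p * (z - s) ≤ h z) (hs : s ∈ Icc 1 L) :
    16 * (L * (h s + p * (L - s)) + h s * (L - s) + p * (L - s) ^ 2 / 2) ≤ profileSlope L h s := by
  have hL : L ∈ Icc 1 L := ⟨hs.1.trans hs.2, le_rfl⟩
  have h1 : ∫ z in s..L, (h s + p * (z - s)) ≤ ∫ z in s..L, h z :=
    intervalIntegral.integral_mono_on hs.2 (Continuous.intervalIntegrable (by fun_prop) _ _)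
      (intervalIntegrable_of_mem hi hs hL) fun z hz => hl z (hs.1.trans hz.1)
  rw [integral_affine] at h1
  have h2 := mul_le_mul_of_nonneg_left (hl L hL.1) (by linarith [hL.1] : 0 ≤ L)
  rw [profileSlope]
  linarith

/-- The main inequality for the profile of a convex `h`. -/
lemma profile_supersolution {h : ℝ → ℝ} {L : ℝ} (hi : IntervalIntegrable h volume 1 L)
    (h0 : ∀ z, 1 ≤ z → 0 ≤ h z) (hc : ConvexOn ℝ (Ici 1) h)
    (hm : MonotoneOn (fun z => z ^ 2 * h z) (Ici 1))
    {s a b : ℝ} (hs : s ∈ Icc 1 L) (ha : a ∈ Icc 1 L) (hb : b ∈ Icc 1 L) (hab : a + b ≤ 2 * s) :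
    8 * h s * (s ^ 2 - a * b) + (profile L h a + profile L h b) / 2 ≤ profile L h s := by
  wlog hba : b ≤ a generalizing a b
  · have := this hb ha (by linarith) (le_of_not_ge hba)
    linarith
  -- A supporting line exists only at interior points, so s = 1 is treated apart.
  rcases hs.1.eq_or_lt with rfl | hs1
  · have ha1 : a = 1 := by linarith [ha.1, hb.1]
    have hb1 : b = 1 := by linarith [ha.1, hb.1]
    subst ha1; subst hb1
    simp [profile_one]
  obtain ⟨p, hp⟩ := exists_supporting_slope hc hs1
  -- In these coordinates a = M + r, b = M - r, s = M + e, and s² - ab = e(s + M) + r². The `e` part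
  -- has to be paid by the slope at `s` and by `J1`, the r² part by the tent integral `J2 - J3`.
  obtain ⟨M, hM⟩ : ∃ M, M = (a + b) / 2 := ⟨_, rfl⟩
  obtain ⟨r, hr⟩ : ∃ r, r = (a - b) / 2 := ⟨_, rfl⟩
  obtain ⟨e, he⟩ : ∃ e, e = s - M := ⟨_, rfl⟩
  have hMm : M ∈ Icc 1 L := ⟨by linarith [ha.1, hb.1], by linarith [ha.2, hb.2]⟩
  have hMs : M ≤ s := by linarith
  have haM : M ≤ a := by linarith
  have hbM : b ≤ M := by linarith
  have hz : ∀ z, 1 ≤ z → (0 : ℝ) + 0 * (z - 0) ≤ h z := by simpa using h0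
  have hc0 := h0 s hs.1
  have key := profile_midpoint_defect hi hs ha hb hM
  have n1 := affine_moment_le hi hz hMm hs hMs le_rfl
  have n2 := affine_moment_le hi hz hb hMm hbM le_rfl
  have n3 := integral_mul_sub_le_affine hi hz hMm ha haM le_rfl
  have l1 := affine_moment_le hi hp hMm hs hMs le_rfl
  have l2 := affine_moment_le hi hp hb hMm hbM le_rfl
  have l3 := integral_mul_sub_le_affine hi hp hMm ha haM le_rfl
  have T1 := profileSlope_ge_of_monotoneOn hi hm hs
  have T2 := profileSlope_ge_affine hi hp hs
  generalize profileSlope L h s = T at *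
  generalize (∫ z in M..s, h z * (z - M)) = J1 at *
  generalize (∫ z in b..M, h z * (z - b)) = J2 at *
  generalize (∫ z in M..a, h z * (z - a)) = J3 at *
  have hsx : s = M + e := by linarith
  have hax : a = M + r := by linarith
  have hbx : b = M - r := by linarith
  have he0 : 0 ≤ e := by linarith
  have hr0 : 0 ≤ r := by linarith
  have hrM : r ≤ M := by linarith [hb.1]
  have haL := ha.2
  have hsL := hs.2
  have hs0 := hs.1
  generalize h s = c at *
  have goal : 8 * c * (s ^ 2 - a * b) ≤ e * T + 16 * J1 + 8 * (J2 - J3) → 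
      8 * c * (s ^ 2 - a * b) + (profile L h a + profile L h b) / 2 ≤ profile L h s := by
    intro hg
    rw [he] at hg
    linarith
  apply goal
  -- The tent kernel on [b, a] is symmetric about `M` with mass r², so it sees the supporting line
  -- only through its value c - pe at `M`.
  have tent : r ^ 2 * (c - p * e) ≤ J2 - J3 := by
    refine le_trans (le_of_eq ?_) (sub_le_sub l2 l3)
    rw [hax, hbx, hsx]
    ring
  have hj1 : c * e ^ 2 / 2 - p * e ^ 3 / 6 ≤ J1 := by
    refine le_trans (le_of_eq ?_) l1
    rw [hsx]
    ring
  have e1 : s ^ 2 - a * b = e * (s + M) + r ^ 2 := by rw [hax, hbx, hsx]; ring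
  have n1' : 0 ≤ J1 := by linarith
  have n2' : 0 ≤ J2 := by linarith
  have n3' : J3 ≤ 0 := by linarith
  clear n1 n2 n3 l1 l2 l3 key goal hp hz hm hc h0 hi
  rw [e1]
  have T1' := mul_le_mul_of_nonneg_left T1 he0
  -- If r ≤ e, the slope bound 16cs alone pays for everything, r² included.
  rcases le_total r e with hre | hre
  · have : c * r ^ 2 ≤ c * e ^ 2 := mul_le_mul_of_nonneg_left (by gcongr) hc0
    rw [hsx] at T1' ⊢
    linarith
  -- If p ≤ 0, the tent already pays 8cr². For p > 0 it falls short by up to 8per², which must come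
  -- from the slope at `s`.
  rcases le_total p 0 with hp0 | hp0
  · have h1 : 0 ≤ r ^ 2 * (-p * e) := by
      have : 0 ≤ -p := by linarith
      positivity
    have h2 : 0 ≤ c * e ^ 2 := by positivity
    rw [hsx] at T1' ⊢
    linarith
  have hpa : p * (a - s) ≤ p * (L - s) := by gcongr
  have has : s ≤ a := by linarith
  -- Since p ≥ 0 and s ≤ a ≤ L, the affine bound on the slope only decreases when `L` is replaced by
  -- `a`.
  have T3 : 16 * (a * (c + p * (a - s)) + c * (a - s) + p * (a - s) ^ 2 / 2) ≤ T := by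
    refine le_trans ?_ T2
    have h1 : 0 ≤ p * (a - s) := mul_nonneg hp0 (by linarith)
    have h2 : a * (c + p * (a - s)) ≤ L * (c + p * (L - s)) :=
      mul_le_mul haL (by linarith) (by linarith) (by linarith)
    have h3 : c * (a - s) ≤ c * (L - s) := by gcongr
    have h4 : p * (a - s) ^ 2 ≤ p * (L - s) ^ 2 := by
      have : 0 ≤ a - s := by linarith
      gcongr
    linarith
  have T3' := mul_le_mul_of_nonneg_left T3 he0
  -- For e ≤ r ≤ 3e the tent and the terms in `p` can be discarded: the surplus is 8c(r - e)(3e -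
  -- r). For r ≥ 3e both are kept, and the terms in `p` balance because a ≥ 2r and r - e ≥ 2r/3.
  rcases le_total r (3 * e) with hr3 | hr3
  · have h1 : 0 ≤ e * (a * (p * (a - s)) + p * (a - s) ^ 2 / 2) := by
      have : 0 ≤ a - s := by linarith
      have : 0 ≤ a := by linarith
      positivity
    have h2 : 0 ≤ c * ((r - e) * (3 * e - r)) :=
      mul_nonneg hc0 (mul_nonneg (by linarith) (by linarith))
    rw [hsx, hax] at T3' h1
    rw [hsx]
    linarith
  · have h1 : 0 ≤ c * (e * (4 * (r - e) + 2 * e)) := by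
      have : 0 ≤ r - e := by linarith
      positivity
    have h2 : 0 ≤ 2 * a * (r - e) + (r - e) ^ 2 - e ^ 2 / 3 - r ^ 2 := by
      have h3 : 2 * (2 * r) * (2 * r / 3) ≤ 2 * a * (r - e) :=
        mul_le_mul (by linarith) (by linarith) (by positivity) (by linarith)
      have h4 : e ^ 2 ≤ r ^ 2 := by gcongr
      nlinarith [sq_nonneg (r - e), sq_nonneg r]
    have h5 := mul_nonneg (mul_nonneg hp0 he0) h2
    rw [hax] at h5
    rw [hsx, hax] at T3'
    rw [hsx]
    linarith

/-! ### Integrability and the supersolution property for decreasing `f`. -/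

lemma intervalIntegrable_div_of_antitoneOn {f : ℝ → ℝ} (hf : AntitoneOn f (Ici 1)) {u v : ℝ}
    (hu : 1 ≤ u) (hv : 1 ≤ v) : IntervalIntegrable (fun z => f z / z) volume u v := by
  have hsub : uIcc u v ⊆ Ici 1 := fun z hz => (le_inf hu hv).trans hz.1
  refine ((hf.mono hsub).intervalIntegrable).mul_continuousOn
    (continuousOn_inv₀.mono fun z hz => ?_)
  have : (1 : ℝ) ≤ z := hsub hz
  simp only [mem_compl_iff, mem_singleton_iff]
  linarith

/-- The candidate in the decreasing case. -/
lemma canda_supersolution {f : ℝ → ℝ} (h0 : ∀ z, 1 ≤ z → 0 ≤ f z) (hf : AntitoneOn f (Ici 1))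
    {s a b : ℝ} (hs : 1 ≤ s) (ha : 1 ≤ a) (hb : 1 ≤ b) :
    8 * f s * (1 - a * b / s ^ 2) + (canda f a + canda f b) / 2 ≤ canda f s := by
  have hint : ∀ u v : ℝ, 1 ≤ u → 1 ≤ v → IntervalIntegrable (fun z => f z / z) volume u v :=
    fun u v hu hv => intervalIntegrable_div_of_antitoneOn hf hu hv
  have hinv : ∀ u v : ℝ, 1 ≤ u → 1 ≤ v → IntervalIntegrable (fun z : ℝ => f s * z⁻¹) volume u v := by
    intro u v hu hv
    refine (ContinuousOn.intervalIntegrable (continuousOn_inv₀.mono fun z hz => ?_)).const_mul _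
    have : (1 : ℝ) ≤ z := (le_inf hu hv).trans hz.1
    simp only [mem_compl_iff, mem_singleton_iff]
    linarith
  -- Replacing `f` by f(s) lowers the oriented integral from `t` to `s` on either side of `s`, since
  -- `f` decreases.
  have step : ∀ t : ℝ, 1 ≤ t → 16 * (f s * Real.log (s / t)) ≤ canda f s - canda f t := by
    intro t ht
    have e1 : canda f s - canda f t = 16 * ∫ z in t..s, f z / z := by
      rw [canda, canda, ← mul_sub, intervalIntegral.integral_interval_sub_left
        (hint 1 s le_rfl hs) (hint 1 t le_rfl ht)]
    have e2 : f s * Real.log (s / t) = ∫ z in t..s, f s * z⁻¹ := by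
      rw [intervalIntegral.integral_const_mul, integral_inv_of_pos (by linarith) (by linarith)]
    rw [e1, e2]
    refine mul_le_mul_of_nonneg_left ?_ (by norm_num)
    rcases le_total t s with hts | hts
    · refine intervalIntegral.integral_mono_on hts (hinv t s ht hs) (hint t s ht hs) fun z hz => ?_
      have hz1 : 1 ≤ z := ht.trans hz.1
      rw [div_eq_mul_inv]
      exact mul_le_mul_of_nonneg_right (hf hz1 hs hz.2) (by positivity)
    · rw [intervalIntegral.integral_symm, intervalIntegral.integral_symm s t]
      refine neg_le_neg (intervalIntegral.integral_mono_on hts (hint s t hs ht) (hinv s t hs ht)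
        fun z hz => ?_)
      have hz1 : 1 ≤ z := hs.trans hz.1
      rw [div_eq_mul_inv]
      exact mul_le_mul_of_nonneg_right (hf hs hz1 hz.1) (by positivity)
  have hlog : 1 - a * b / s ^ 2 ≤ Real.log (s / a) + Real.log (s / b) := by
    rw [← Real.log_mul (by positivity) (by positivity)]
    have h1 := Real.one_sub_inv_le_log_of_pos (x := s / a * (s / b)) (by positivity)
    have h2 : (s / a * (s / b))⁻¹ = a * b / s ^ 2 := by field_simp
    rwa [h2] at h1
  have h1 := step a ha
  have h2 := step b hb
  have h3 := mul_le_mul_of_nonneg_left hlog (h0 s hs)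
  linarith

lemma canda_nonneg {f : ℝ → ℝ} (h0 : ∀ z, 1 ≤ z → 0 ≤ f z) {s : ℝ} (hs : 1 ≤ s) :
    0 ≤ canda f s := by
  refine mul_nonneg (by norm_num) (intervalIntegral.integral_nonneg hs fun z hz => ?_)
  have := hz.1
  exact div_nonneg (h0 z hz.1) (by linarith)

/-! ### Dyadic intervals -/

attribute [ext] Ivl

lemma Ivl.len_pos (I : Ivl) : 0 < I.len := sub_pos.mpr I.lt

lemma Ivl.leftHalf_len (I : Ivl) : I.leftHalf.len = I.len / 2 := by
  simp only [Ivl.len, Ivl.leftHalf]; ring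

lemma Ivl.rightHalf_len (I : Ivl) : I.rightHalf.len = I.len / 2 := by
  simp only [Ivl.len, Ivl.rightHalf]; ring

lemma Ivl.sub_zero_zero (I : Ivl) : I.sub 0 0 = I := by
  ext <;> simp [Ivl.sub, Ivl.len]

lemma Ivl.leftHalf_sub (I : Ivl) (n k : ℕ) : I.leftHalf.sub n k = I.sub (n + 1) k := by
  ext <;> simp only [Ivl.sub, Ivl.leftHalf_len] <;> simp only [Ivl.leftHalf, pow_succ] <;>
    field_simp

lemma Ivl.rightHalf_sub (I : Ivl) (n k : ℕ) :
    I.rightHalf.sub n k = I.sub (n + 1) (2 ^ n + k) := by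
  ext <;> simp only [Ivl.sub, Ivl.rightHalf_len] <;>
    simp only [Ivl.rightHalf, Ivl.len, pow_succ, Nat.cast_add, Nat.cast_pow, Nat.cast_ofNat] <;>
    field_simp <;> ring

lemma Ivl.sub_left_le (I : Ivl) (n k : ℕ) : I.left ≤ (I.sub n k).left := by
  have : 0 ≤ (k : ℝ) * (I.len / 2 ^ n) :=
    mul_nonneg k.cast_nonneg (div_nonneg I.len_pos.le (by positivity))
  simp only [Ivl.sub]
  linarith

lemma Ivl.sub_right_le (I : Ivl) {n k : ℕ} (hk : k < 2 ^ n) : (I.sub n k).right ≤ I.right := by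
  have h1 : ((k : ℝ) + 1) ≤ 2 ^ n := by exact_mod_cast hk
  have h2 : ((k : ℝ) + 1) * (I.len / 2 ^ n) ≤ 2 ^ n * (I.len / 2 ^ n) :=
    mul_le_mul_of_nonneg_right h1 (div_nonneg I.len_pos.le (by positivity))
  rw [mul_div_cancel₀ _ (by positivity)] at h2
  simp only [Ivl.sub]
  simp only [Ivl.len] at *
  linarith

/-- Splitting the sum over a generation according to the two halves. -/
lemma sum_generation_succ (I : Ivl) (F : Ivl → ENNReal) (n : ℕ) :
    ∑ k ∈ Finset.range (2 ^ (n + 1)), F (I.sub (n + 1) k) =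
      (∑ k ∈ Finset.range (2 ^ n), F (I.leftHalf.sub n k))
        + ∑ k ∈ Finset.range (2 ^ n), F (I.rightHalf.sub n k) := by
  rw [pow_succ, mul_two, Finset.sum_range_add]
  simp only [Ivl.leftHalf_sub, Ivl.rightHalf_sub]

/-! ### Averages -/

lemma avg_congr {w v : ℝ → ℝ} {J : Ivl} (h : ∀ x ∈ Ioc J.left J.right, w x = v x) :
    avg w J = avg v J := by
  rw [avg, avg, intervalIntegral.integral_congr_ae]
  refine Filter.Eventually.of_forall fun x hx => h x ?_
  rwa [uIoc_of_le J.lt.le] at hx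

lemma avg_const (a : ℝ) (J : Ivl) : avg (fun _ => a) J = a := by
  have := J.len_pos.ne'
  rw [avg, intervalIntegral.integral_const, smul_eq_mul, ← Ivl.len]
  field_simp

lemma IsWeightOn.mono {w : ℝ → ℝ} {I J : Ivl} (hw : IsWeightOn w I) (hl : I.left ≤ J.left)
    (hr : J.right ≤ I.right) : IsWeightOn w J where
  integrable := by
    refine hw.integrable.mono_set ?_
    rw [uIcc_of_le J.lt.le, uIcc_of_le I.lt.le]
    exact Icc_subset_Icc hl hr
  pos := by
    filter_upwards [hw.pos] with x hx hxJ
    exact hx ⟨hl.trans hxJ.1, hxJ.2.trans hr⟩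

lemma Ivl.leftHalf_right_le (I : Ivl) : I.leftHalf.right ≤ I.right := by
  simp only [Ivl.leftHalf]; linarith [I.lt]

lemma Ivl.left_le_rightHalf_left (I : Ivl) : I.left ≤ I.rightHalf.left := by
  simp only [Ivl.rightHalf]; linarith [I.lt]

lemma IsWeightOn.leftHalf {w : ℝ → ℝ} {I : Ivl} (hw : IsWeightOn w I) : IsWeightOn w I.leftHalf :=
  hw.mono le_rfl I.leftHalf_right_le

lemma IsWeightOn.rightHalf {w : ℝ → ℝ} {I : Ivl} (hw : IsWeightOn w I) :
    IsWeightOn w I.rightHalf :=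
  hw.mono I.left_le_rightHalf_left le_rfl

lemma avg_eq_of_halves {w : ℝ → ℝ} {I : Ivl} (hl : IsWeightOn w I.leftHalf)
    (hr : IsWeightOn w I.rightHalf) :
    avg w I = (avg w I.leftHalf + avg w I.rightHalf) / 2 := by
  have h := intervalIntegral.integral_add_adjacent_intervals hl.integrable hr.integrable
  have hne := I.len_pos.ne'
  rw [avg, avg, avg, I.leftHalf_len, I.rightHalf_len]
  simp only [Ivl.leftHalf, Ivl.rightHalf] at *
  rw [← h]
  field_simp

lemma IsWeightOn.pos_Ioc {w : ℝ → ℝ} {I : Ivl} (hw : IsWeightOn w I) :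
    ∀ᵐ x ∂(volume.restrict (Ioc I.left I.right)), 0 < w x := by
  rw [ae_restrict_iff' measurableSet_Ioc]
  filter_upwards [hw.pos] with x hx hxI
  exact hx (Ioc_subset_Icc_self hxI)

lemma IsWeightOn.avg_pos {w : ℝ → ℝ} {I : Ivl} (hw : IsWeightOn w I) : 0 < avg w I := by
  refine mul_pos (inv_pos.mpr I.len_pos) ?_
  rw [intervalIntegral.integral_of_le I.lt.le]
  rw [integral_pos_iff_support_of_nonneg_ae (hw.pos_Ioc.mono fun x hx => hx.le)
    hw.integrable.1]
  have h1 : (volume.restrict (Ioc I.left I.right)) (Function.support w)ᶜ = 0 := by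
    have := hw.pos_Ioc
    rw [ae_iff] at this
    refine measure_mono_null (fun x hx => ?_) this
    simp only [mem_compl_iff, Function.mem_support, not_not] at hx
    simp [hx]
  rw [measure_of_measure_compl_eq_zero h1]
  simpa using I.lt

lemma one_le_avg_mul_avg_recip {w : ℝ → ℝ} {I : Ivl} (hw : IsWeightOn w I)
    (hw' : IsWeightOn (recip w) I) : 1 ≤ avg w I * avg (recip w) I := by
  have hp := hw.avg_pos
  have hl := I.len_pos
  set c := avg w I with hc
  have h1 : ∫ x in I.left..I.right, (2 : ℝ) ≤
      ∫ x in I.left..I.right, (c⁻¹ * w x + c * recip w x) := by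
    rw [intervalIntegral.integral_of_le I.lt.le, intervalIntegral.integral_of_le I.lt.le]
    refine integral_mono_ae (integrable_const _)
      ((hw.integrable.1.const_mul _).add (hw'.integrable.1.const_mul _)) ?_
    filter_upwards [hw.pos_Ioc] with x hx
    simp only [recip]
    -- Pointwise AM-GM, normalised by the average `c` so that integration yields the product of
    -- averages.
    have h2 : c⁻¹ * w x + c * (w x)⁻¹ - 2 = (w x - c) ^ 2 / (c * w x) := by
      field_simp
      ring
    have h3 : 0 ≤ (w x - c) ^ 2 / (c * w x) := by positivity
    linarith
  rw [intervalIntegral.integral_add (hw.integrable.const_mul _) (hw'.integrable.const_mul _),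
    intervalIntegral.integral_const_mul, intervalIntegral.integral_const_mul,
    intervalIntegral.integral_const, smul_eq_mul, ← Ivl.len] at h1
  have e1 : ∫ x in I.left..I.right, w x = I.len * c := by
    rw [hc, avg]; field_simp
  have e2 : ∫ x in I.left..I.right, recip w x = I.len * avg (recip w) I := by
    rw [avg]; field_simp
  rw [e1, e2] at h1
  have e3 : c⁻¹ * (I.len * c) = I.len := by field_simp
  rw [e3] at h1
  have : I.len * 1 ≤ I.len * (c * avg (recip w) I) := by linarith
  exact le_of_mul_le_mul_left this hl

/-! ### The class of weights -/

lemma mem_A2_iff {Q : ℝ} (hQ : 0 ≤ Q) {w : ℝ → ℝ} {I : Ivl} :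
    w ∈ A2 Q I ↔ IsWeightOn w I ∧ IsWeightOn (recip w) I ∧
      ∀ n k, k < 2 ^ n → avg w (I.sub n k) * avg (recip w) (I.sub n k) ≤ Q := by
  simp only [A2, mem_ofPred_eq, a2Char, iSup_le_iff, ENNReal.ofReal_le_ofReal_iff hQ]

lemma A2_avg_le {Q : ℝ} (hQ : 0 ≤ Q) {w : ℝ → ℝ} {I : Ivl} (hw : w ∈ A2 Q I) :
    avg w I * avg (recip w) I ≤ Q := by
  have := ((mem_A2_iff hQ).1 hw).2.2 0 0 (by simp)
  rwa [Ivl.sub_zero_zero] at this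

/-- Membership in the class, in terms of the two halves. -/
lemma mem_A2_iff_halves {Q : ℝ} (hQ : 0 ≤ Q) {w : ℝ → ℝ} {I : Ivl} :
    w ∈ A2 Q I ↔ w ∈ A2 Q I.leftHalf ∧ w ∈ A2 Q I.rightHalf ∧
      avg w I * avg (recip w) I ≤ Q := by
  have wt : ∀ v : ℝ → ℝ, IsWeightOn v I.leftHalf → IsWeightOn v I.rightHalf → IsWeightOn v I := by
    intro v h1 h2
    refine ⟨h1.integrable.trans h2.integrable, ?_⟩
    filter_upwards [h1.pos, h2.pos] with x hx1 hx2 hx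
    rcases le_total x ((I.left + I.right) / 2) with h | h
    · exact hx1 ⟨hx.1, h⟩
    · exact hx2 ⟨h, hx.2⟩
  constructor
  · intro hw
    have hw0 := (mem_A2_iff hQ).1 hw
    refine ⟨(mem_A2_iff hQ).2 ⟨hw0.1.leftHalf, hw0.2.1.leftHalf, fun n k hk => ?_⟩,
      (mem_A2_iff hQ).2 ⟨hw0.1.rightHalf, hw0.2.1.rightHalf, fun n k hk => ?_⟩, A2_avg_le hQ hw⟩
    · rw [Ivl.leftHalf_sub]
      exact hw0.2.2 _ _ (by rw [pow_succ]; omega)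
    · rw [Ivl.rightHalf_sub]
      exact hw0.2.2 _ _ (by rw [pow_succ]; omega)
  · rintro ⟨h1, h2, h3⟩
    rw [mem_A2_iff hQ] at h1 h2
    refine (mem_A2_iff hQ).2 ⟨wt _ h1.1 h2.1, wt _ h1.2.1 h2.2.1, fun n k hk => ?_⟩
    rcases n with _ | n
    · have : k = 0 := by simpa using hk
      rwa [this, Ivl.sub_zero_zero]
    · rcases lt_or_ge k (2 ^ n) with hk' | hk'
      · rw [← Ivl.leftHalf_sub]
        exact h1.2.2 n k hk'
      · obtain ⟨j, rfl⟩ := Nat.exists_eq_add_of_le hk'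
        rw [← Ivl.rightHalf_sub]
        exact h2.2.2 n j (by rw [pow_succ] at hk; omega)

/-! ### The dyadic sum -/

/-- The part of the dyadic sum that comes from the first `N` generations. -/
noncomputable def partialSum (Φ : ℝ → ℝ) (w : ℝ → ℝ) (N : ℕ) (I : Ivl) : ENNReal :=
  (ENNReal.ofReal I.len)⁻¹ *
    ∑ n ∈ Finset.range N, ∑ k ∈ Finset.range (2 ^ n), ENNReal.ofReal (c Φ w (I.sub n k))

lemma dyadicSum_eq_iSup (Φ : ℝ → ℝ) (w : ℝ → ℝ) (I : Ivl) :
    dyadicSum Φ w I = ⨆ N, partialSum Φ w N I := by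
  simp only [dyadicSum, partialSum, ENNReal.tsum_eq_iSup_nat, ENNReal.mul_iSup]

lemma inv_ofReal_len_half {a b : ℝ} (h : b = a / 2) :
    (ENNReal.ofReal a)⁻¹ = 2⁻¹ * (ENNReal.ofReal b)⁻¹ := by
  rw [← ENNReal.mul_inv (by simp) (by simp), h, ENNReal.ofReal_div_of_pos (by norm_num),
    ENNReal.ofReal_ofNat, ENNReal.mul_div_cancel (by simp) (by simp)]

lemma ofReal_add_half {p a b : ℝ} (hp : 0 ≤ p) (ha : 0 ≤ a) (hb : 0 ≤ b) :
    ENNReal.ofReal p + 2⁻¹ * (ENNReal.ofReal a + ENNReal.ofReal b) =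
      ENNReal.ofReal (p + (a + b) / 2) := by
  rw [ENNReal.ofReal_add hp (by positivity), div_eq_inv_mul, ENNReal.ofReal_mul (by norm_num),
    ENNReal.ofReal_add ha hb, ENNReal.ofReal_inv_of_pos (by norm_num), ENNReal.ofReal_ofNat]

lemma inv_len_mul_c (Φ : ℝ → ℝ) (w : ℝ → ℝ) (I : Ivl) :
    (ENNReal.ofReal I.len)⁻¹ * ENNReal.ofReal (c Φ w I) =
      ENNReal.ofReal (Φ (avg w I * avg (recip w) I) * R w I) := by
  have hl := I.len_pos
  rw [c, mul_assoc, ENNReal.ofReal_mul hl.le, ← mul_assoc, ENNReal.inv_mul_cancel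
    (by simpa using hl) (by simp), one_mul]

lemma partialSum_succ (Φ : ℝ → ℝ) (w : ℝ → ℝ) (N : ℕ) (I : Ivl) :
    partialSum Φ w (N + 1) I =
      ENNReal.ofReal (Φ (avg w I * avg (recip w) I) * R w I) +
        2⁻¹ * (partialSum Φ w N I.leftHalf + partialSum Φ w N I.rightHalf) := by
  rw [partialSum, Finset.sum_range_succ', pow_zero, Finset.sum_range_one, Ivl.sub_zero_zero,
    add_comm, mul_add, inv_len_mul_c]
  simp only [sum_generation_succ I (fun J => ENNReal.ofReal (c Φ w J)), Finset.sum_add_distrib]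
  rw [mul_add, mul_add, inv_ofReal_len_half I.leftHalf_len, mul_assoc, partialSum, partialSum,
    I.leftHalf_len, I.rightHalf_len, mul_assoc]

lemma dyadicSum_eq (Φ : ℝ → ℝ) (w : ℝ → ℝ) (I : Ivl) :
    dyadicSum Φ w I = ENNReal.ofReal (Φ (avg w I * avg (recip w) I) * R w I) +
        2⁻¹ * (dyadicSum Φ w I.leftHalf + dyadicSum Φ w I.rightHalf) := by
  rw [dyadicSum, tsum_eq_zero_add' ENNReal.summable, pow_zero, Finset.sum_range_one,
    Ivl.sub_zero_zero, mul_add, inv_len_mul_c]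
  simp only [sum_generation_succ I (fun J => ENNReal.ofReal (c Φ w J))]
  rw [ENNReal.tsum_add, mul_add, mul_add, inv_ofReal_len_half I.leftHalf_len, mul_assoc,
    dyadicSum, dyadicSum, I.leftHalf_len, I.rightHalf_len, mul_assoc]

/-- The weighted square of the relative jumps is controlled by the loss of the geometric mean. -/
lemma R_le {w : ℝ → ℝ} {I : Ivl} (hw : IsWeightOn w I) (hw' : IsWeightOn (recip w) I)
    {s a b : ℝ} (hs : s = Real.sqrt (avg w I * avg (recip w) I))
    (ha : a = Real.sqrt (avg w I.leftHalf * avg (recip w) I.leftHalf))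
    (hb : b = Real.sqrt (avg w I.rightHalf * avg (recip w) I.rightHalf)) :
    R w I ≤ 8 * (1 - a * b / s ^ 2) ∧ a + b ≤ 2 * s := by
  have p1 := hw.leftHalf.avg_pos
  have p2 := hw.rightHalf.avg_pos
  have p3 := hw'.leftHalf.avg_pos
  have p4 := hw'.rightHalf.avg_pos
  have e1 := avg_eq_of_halves hw.leftHalf hw.rightHalf
  have e2 := avg_eq_of_halves hw'.leftHalf hw'.rightHalf
  simp only [R, delta]
  generalize avg w I.leftHalf = x₁ at *
  generalize avg w I.rightHalf = y₁ at *
  generalize avg (recip w) I.leftHalf = x₂ at *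
  generalize avg (recip w) I.rightHalf = y₂ at *
  rw [e1, e2] at hs ⊢
  have ha0 : 0 ≤ a := ha ▸ Real.sqrt_nonneg _
  have hb0 : 0 ≤ b := hb ▸ Real.sqrt_nonneg _
  have hs0 : 0 ≤ s := hs ▸ Real.sqrt_nonneg _
  have ha2 : a ^ 2 = x₁ * x₂ := by rw [ha, Real.sq_sqrt (by positivity)]
  have hb2 : b ^ 2 = y₁ * y₂ := by rw [hb, Real.sq_sqrt (by positivity)]
  have hs2 : s ^ 2 = (x₁ + y₁) / 2 * ((x₂ + y₂) / 2) := by rw [hs, Real.sq_sqrt (by positivity)]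
  have hab : 2 * (a * b) ≤ x₁ * y₂ + y₁ * x₂ := by
    refine abs_le_of_sq_le_sq' ?_ (by positivity) |>.2
    have : (2 * (a * b)) ^ 2 = 4 * (x₁ * x₂) * (y₁ * y₂) := by rw [← ha2, ← hb2]; ring
    rw [this]
    nlinarith [sq_nonneg (x₁ * y₂ - y₁ * x₂)]
  refine ⟨?_, abs_le_of_sq_le_sq' (by nlinarith) (by positivity) |>.2⟩
  have h1 : (x₁ - y₁) ^ 2 / ((x₁ + y₁) / 2) ^ 2 = 4 - 16 * (x₁ * y₁) / (x₁ + y₁) ^ 2 := by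
    field_simp; ring
  have h2 : (x₂ - y₂) ^ 2 / ((x₂ + y₂) / 2) ^ 2 = 4 - 16 * (x₂ * y₂) / (x₂ + y₂) ^ 2 := by
    field_simp; ring
  rw [h1, h2, hs2]
  have h3 : a * b / ((x₁ + y₁) / 2 * ((x₂ + y₂) / 2)) = 4 * (a * b) / ((x₁ + y₁) * (x₂ + y₂)) := by
    field_simp; ring
  -- The gap in the estimate is an exact square, which vanishes when both averages have relative
  -- jumps of the same size.
  have h4 : 16 * (x₁ * y₁) / (x₁ + y₁) ^ 2 + 16 * (x₂ * y₂) / (x₂ + y₂) ^ 2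
      - 2 * (16 * (a * b) / ((x₁ + y₁) * (x₂ + y₂)))
      = 16 * (Real.sqrt (x₁ * y₁) / (x₁ + y₁) - Real.sqrt (x₂ * y₂) / (x₂ + y₂)) ^ 2 := by
    have h5 : a * b = Real.sqrt (x₁ * y₁) * Real.sqrt (x₂ * y₂) := by
      rw [ha, hb, ← Real.sqrt_mul (by positivity), ← Real.sqrt_mul (by positivity)]
      congr 1; ring
    rw [h5, sub_sq, div_pow, div_pow, Real.sq_sqrt (by positivity), Real.sq_sqrt (by positivity)]
    field_simp
    ring
  have h6 := sq_nonneg (Real.sqrt (x₁ * y₁) / (x₁ + y₁) - Real.sqrt (x₂ * y₂) / (x₂ + y₂))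
  rw [h3]
  have h7 : 8 * (1 - 4 * (a * b) / ((x₁ + y₁) * (x₂ + y₂))) =
      8 - 2 * (16 * (a * b) / ((x₁ + y₁) * (x₂ + y₂))) := by ring
  rw [h7]
  linarith

lemma R_nonneg (w : ℝ → ℝ) (I : Ivl) : 0 ≤ R w I := by
  unfold R
  positivity

/-- A supersolution of the dyadic inequality dominates the dyadic sum. -/
theorem dyadicSum_le_of_supersolution {Q L : ℝ} (hQ : 0 ≤ Q) (hL : L = Real.sqrt Q) {Φ G : ℝ → ℝ}
    (hΦ : ∀ t, 1 ≤ t → 0 ≤ Φ t) (hG0 : ∀ s ∈ Icc 1 L, 0 ≤ G s)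
    (hG : ∀ s ∈ Icc 1 L, ∀ a ∈ Icc 1 L, ∀ b ∈ Icc 1 L, a + b ≤ 2 * s →
      8 * fOf Φ s * (1 - a * b / s ^ 2) + (G a + G b) / 2 ≤ G s)
    {w : ℝ → ℝ} {I : Ivl} (hw : w ∈ A2 Q I) :
    dyadicSum Φ w I ≤ ENNReal.ofReal (G (Real.sqrt (avg w I * avg (recip w) I))) := by
  have hmem : ∀ J : Ivl, w ∈ A2 Q J → Real.sqrt (avg w J * avg (recip w) J) ∈ Icc 1 L := by
    intro J hJ
    have h1 := one_le_avg_mul_avg_recip hJ.1 hJ.2.1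
    exact ⟨Real.one_le_sqrt.mpr h1, hL ▸ Real.sqrt_le_sqrt (A2_avg_le hQ hJ)⟩
  rw [dyadicSum_eq_iSup]
  refine iSup_le fun N => ?_
  induction N generalizing I with
  | zero => simp [partialSum]
  | succ N ih =>
    obtain ⟨hl, hr, -⟩ := (mem_A2_iff_halves hQ).1 hw
    have hs := hmem I hw
    have ha := hmem _ hl
    have hb := hmem _ hr
    have hprod := one_le_avg_mul_avg_recip hw.1 hw.2.1
    obtain ⟨hR, hab⟩ := R_le hw.1 hw.2.1 rfl rfl rfl
    have key := hG _ hs _ ha _ hb hab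
    have hf : fOf Φ (Real.sqrt (avg w I * avg (recip w) I)) = Φ (avg w I * avg (recip w) I) := by
      rw [fOf, Real.sq_sqrt (by linarith)]
    rw [hf] at key
    have h3 := mul_le_mul_of_nonneg_left hR (hΦ _ hprod)
    rw [partialSum_succ]
    calc _ ≤ ENNReal.ofReal (Φ (avg w I * avg (recip w) I) * R w I) + 2⁻¹ *
          (ENNReal.ofReal (G (Real.sqrt (avg w I.leftHalf * avg (recip w) I.leftHalf))) +
          ENNReal.ofReal (G (Real.sqrt (avg w I.rightHalf * avg (recip w) I.rightHalf)))) := by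
            gcongr
            · exact ih hl
            · exact ih hr
      _ = ENNReal.ofReal (Φ (avg w I * avg (recip w) I) * R w I +
          (G (Real.sqrt (avg w I.leftHalf * avg (recip w) I.leftHalf)) +
          G (Real.sqrt (avg w I.rightHalf * avg (recip w) I.rightHalf))) / 2) :=
            ofReal_add_half (mul_nonneg (hΦ _ hprod) (R_nonneg w I)) (hG0 _ ha) (hG0 _ hb)
      _ ≤ _ := ENNReal.ofReal_le_ofReal (by linarith)

/-! ### Concatenation of weights -/

/-- The function equal to `u` on the left half of `I` and to `v` on the right half. -/
noncomputable def glue (I : Ivl) (u v : ℝ → ℝ) : ℝ → ℝ := fun x =>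
  if x ≤ (I.left + I.right) / 2 then u x else v x

lemma glue_eq_left {I : Ivl} {u v : ℝ → ℝ} {x : ℝ} (hx : x ≤ I.leftHalf.right) :
    glue I u v x = u x := if_pos hx

lemma glue_eq_right {I : Ivl} {u v : ℝ → ℝ} {x : ℝ} (hx : I.rightHalf.left < x) :
    glue I u v x = v x := if_neg (not_le.mpr hx)

/-- Agreement on the half-open interval is what `glue` provides, as it gives the midpoint to the
left piece; the omitted endpoint is null. -/
lemma IsWeightOn.congr {u v : ℝ → ℝ} {J : Ivl} (hu : IsWeightOn u J)
    (h : ∀ x ∈ Ioc J.left J.right, u x = v x) : IsWeightOn v J where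
  integrable := hu.integrable.congr (fun x hx => h x (by rwa [uIoc_of_le J.lt.le] at hx))
  pos := by
    have hne : ∀ᵐ x : ℝ, x ≠ J.left := by simp [ae_iff]
    filter_upwards [hu.pos, hne] with x hx hx' hxJ
    rw [← h x ⟨lt_of_le_of_ne hxJ.1 (Ne.symm hx'), hxJ.2⟩]
    exact hx hxJ

lemma avg_sub_congr {u v : ℝ → ℝ} {J : Ivl} (h : ∀ x ∈ Ioc J.left J.right, u x = v x)
    {n k : ℕ} (hk : k < 2 ^ n) : avg u (J.sub n k) = avg v (J.sub n k) :=
  avg_congr fun x hx => h x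
    ⟨(J.sub_left_le n k).trans_lt hx.1, hx.2.trans (J.sub_right_le hk)⟩

lemma recip_congr {u v : ℝ → ℝ} {J : Ivl} (h : ∀ x ∈ Ioc J.left J.right, u x = v x) :
    ∀ x ∈ Ioc J.left J.right, recip u x = recip v x := fun x hx => by
  simp only [recip, h x hx]

lemma A2_congr {Q : ℝ} (hQ : 0 ≤ Q) {u v : ℝ → ℝ} {J : Ivl} (hu : u ∈ A2 Q J)
    (h : ∀ x ∈ Ioc J.left J.right, u x = v x) : v ∈ A2 Q J := by
  rw [mem_A2_iff hQ] at hu ⊢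
  refine ⟨hu.1.congr h, hu.2.1.congr (recip_congr h), fun n k hk => ?_⟩
  rw [← avg_sub_congr h hk, ← avg_sub_congr (recip_congr h) hk]
  exact hu.2.2 n k hk

lemma delta_congr {u v : ℝ → ℝ} {J : Ivl} (h : ∀ x ∈ Ioc J.left J.right, u x = v x) :
    delta u J = delta v J := by
  rw [delta, delta, avg_congr (J := J.leftHalf) fun x hx =>
      h x ⟨hx.1, hx.2.trans J.leftHalf_right_le⟩,
    avg_congr (J := J.rightHalf) fun x hx =>
      h x ⟨J.left_le_rightHalf_left.trans_lt hx.1, hx.2⟩]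

lemma c_congr (Φ : ℝ → ℝ) {u v : ℝ → ℝ} {J : Ivl} (h : ∀ x ∈ Ioc J.left J.right, u x = v x) :
    c Φ u J = c Φ v J := by
  rw [c, c, R, R, delta_congr h, delta_congr (recip_congr h), avg_congr h,
    avg_congr (recip_congr h)]

lemma dyadicSum_congr (Φ : ℝ → ℝ) {u v : ℝ → ℝ} {J : Ivl}
    (h : ∀ x ∈ Ioc J.left J.right, u x = v x) : dyadicSum Φ u J = dyadicSum Φ v J := by
  rw [dyadicSum, dyadicSum]
  congr 1
  refine tsum_congr fun n => Finset.sum_congr rfl fun k hk => ?_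
  rw [c_congr Φ (u := u) (v := v) fun x hx => h x
    ⟨(J.sub_left_le n k).trans_lt hx.1, hx.2.trans (J.sub_right_le (Finset.mem_range.mp hk))⟩]

/-- Concatenation of admissible weights on the two halves of an interval. -/
lemma exists_concat {Q : ℝ} (hQ : 0 ≤ Q) {Φ : ℝ → ℝ} {I : Ivl} {x₁ x₂ y₁ y₂ : ℝ}
    (hprod : (x₁ + y₁) / 2 * ((x₂ + y₂) / 2) ≤ Q)
    {u v : ℝ → ℝ} (hu : u ∈ E Q (x₁, x₂) I.leftHalf) (hv : v ∈ E Q (y₁, y₂) I.rightHalf) :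
    ∃ w ∈ E Q ((x₁ + y₁) / 2, (x₂ + y₂) / 2) I,
      dyadicSum Φ w I = ENNReal.ofReal (Φ ((x₁ + y₁) / 2 * ((x₂ + y₂) / 2)) *
          ((x₁ - y₁) ^ 2 / ((x₁ + y₁) / 2) ^ 2 + (x₂ - y₂) ^ 2 / ((x₂ + y₂) / 2) ^ 2)) +
        2⁻¹ * (dyadicSum Φ u I.leftHalf + dyadicSum Φ v I.rightHalf) := by
  obtain ⟨hu, hux, hux'⟩ := hu
  obtain ⟨hv, hvx, hvx'⟩ := hv
  have hl : ∀ x ∈ Ioc I.leftHalf.left I.leftHalf.right, u x = glue I u v x :=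
    fun x hx => (glue_eq_left hx.2).symm
  have hr : ∀ x ∈ Ioc I.rightHalf.left I.rightHalf.right, v x = glue I u v x :=
    fun x hx => (glue_eq_right hx.1).symm
  have hlA := A2_congr hQ hu hl
  have hrA := A2_congr hQ hv hr
  have a1 := avg_eq_of_halves hlA.1 hrA.1
  have a2 := avg_eq_of_halves hlA.2.1 hrA.2.1
  have b1 := avg_congr hl
  have b2 := avg_congr hr
  have b3 := avg_congr (recip_congr hl)
  have b4 := avg_congr (recip_congr hr)
  simp only at hux hux' hvx hvx'
  rw [hux] at b1
  rw [hvx] at b2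
  rw [hux'] at b3
  rw [hvx'] at b4
  rw [← b1, ← b2] at a1
  rw [← b3, ← b4] at a2
  refine ⟨glue I u v, ⟨(mem_A2_iff_halves hQ).2 ⟨hlA, hrA, ?_⟩, a1, a2⟩, ?_⟩
  · rwa [a1, a2]
  · rw [dyadicSum_eq, R, delta, delta, a1, a2, ← b1, ← b2, ← b3, ← b4, dyadicSum_congr Φ hl,
      dyadicSum_congr Φ hr]

lemma const_mem_E {Q : ℝ} (hQ : 1 ≤ Q) {x₁ x₂ : ℝ} (h1 : 0 < x₁) (h2 : 0 < x₂)
    (h : x₁ * x₂ = 1) (I : Ivl) : (fun _ => x₁) ∈ E Q (x₁, x₂) I := by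
  have hr : recip (fun _ => x₁) = fun _ => x₂ := by
    ext x
    simp only [recip]
    exact inv_eq_of_mul_eq_one_right h
  refine ⟨(mem_A2_iff (by linarith)).2 ⟨⟨by simp, by simp [h1]⟩, ?_, fun n k _ => ?_⟩,
    avg_const _ _, ?_⟩
  · rw [hr]
    exact ⟨by simp, by simp [h2]⟩
  · rw [hr, avg_const, avg_const, h]
    exact hQ
  · rw [hr, avg_const]

/-! ### Attainable values -/

/-- The values that the dyadic sum reaches on every interval and for every pair of averages with
geometric mean `s`. -/
def Attainable (Q : ℝ) (Φ : ℝ → ℝ) (s : ℝ) : Set ℝ :=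
  {g | 0 ≤ g ∧ ∀ (I : Ivl) (x₁ x₂ : ℝ), 0 < x₁ → 0 < x₂ → x₁ * x₂ = s ^ 2 →
    ∃ w ∈ E Q (x₁, x₂) I, ENNReal.ofReal g ≤ dyadicSum Φ w I}

lemma zero_mem_attainable_one {Q : ℝ} (hQ : 1 ≤ Q) (Φ : ℝ → ℝ) : 0 ∈ Attainable Q Φ 1 :=
  ⟨le_rfl, fun I x₁ x₂ h1 h2 h => ⟨_, const_mem_E hQ h1 h2 (by simpa using h) I, by simp⟩⟩

/-- A step in which the two averages are scaled by `1 ± α` and `1 ± β`. -/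
lemma exists_step {Q : ℝ} {Φ : ℝ → ℝ} (hΦ : ∀ t, 1 ≤ t → 0 ≤ Φ t) {s : ℝ} (hs : 1 ≤ s)
    (hsQ : s ^ 2 ≤ Q) {a b g₁ g₂ : ℝ} (h1 : g₁ ∈ Attainable Q Φ a) (h2 : g₂ ∈ Attainable Q Φ b)
    {α β : ℝ} (hα : |α| < 1) (hβ : |β| < 1) (ha : s ^ 2 * ((1 + α) * (1 + β)) = a ^ 2)
    (hb : s ^ 2 * ((1 - α) * (1 - β)) = b ^ 2) :
    Φ (s ^ 2) * (4 * (α ^ 2 + β ^ 2)) + (g₁ + g₂) / 2 ∈ Attainable Q Φ s := by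
  have hp : 0 ≤ Φ (s ^ 2) * (4 * (α ^ 2 + β ^ 2)) := by
    have := hΦ (s ^ 2) (one_le_pow₀ hs)
    positivity
  have hα' := abs_lt.mp hα
  have hβ' := abs_lt.mp hβ
  refine ⟨by linarith [h1.1, h2.1], fun I x₁ x₂ hx₁ hx₂ hx => ?_⟩
  obtain ⟨u, hu, hu'⟩ := h1.2 I.leftHalf (x₁ * (1 + α)) (x₂ * (1 + β))
    (mul_pos hx₁ (by linarith)) (mul_pos hx₂ (by linarith)) (by rw [← ha, ← hx]; ring)
  obtain ⟨v, hv, hv'⟩ := h2.2 I.rightHalf (x₁ * (1 - α)) (x₂ * (1 - β))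
    (mul_pos hx₁ (by linarith)) (mul_pos hx₂ (by linarith)) (by rw [← hb, ← hx]; ring)
  have e1 : (x₁ * (1 + α) + x₁ * (1 - α)) / 2 = x₁ := by ring
  have e2 : (x₂ * (1 + β) + x₂ * (1 - β)) / 2 = x₂ := by ring
  have hw := exists_concat (Q := Q) (by linarith [sq_nonneg s]) (Φ := Φ)
    (by rw [e1, e2, hx]; exact hsQ) hu hv
  rw [e1, e2, hx] at hw
  obtain ⟨w, hw, hsum⟩ := hw
  refine ⟨w, hw, ?_⟩
  have e3 : (x₁ * (1 + α) - x₁ * (1 - α)) ^ 2 / x₁ ^ 2 + (x₂ * (1 + β) - x₂ * (1 - β)) ^ 2 / x₂ ^ 2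
      = 4 * (α ^ 2 + β ^ 2) := by
    field_simp
    ring
  rw [hsum, e3, ← ofReal_add_half hp h1.1 h2.1]
  gcongr

/-- Take β = -α with α² = 1 - t²/s²: both halves then have geometric mean `t`, and the jump estimate
is sharp. -/
lemma attainable_down {Q : ℝ} {Φ : ℝ → ℝ} (hΦ : ∀ t, 1 ≤ t → 0 ≤ Φ t) {s t g : ℝ} (ht : 1 ≤ t)
    (hts : t ≤ s) (hsQ : s ^ 2 ≤ Q) (hg : g ∈ Attainable Q Φ t) :
    8 * fOf Φ s * (1 - t ^ 2 / s ^ 2) + g ∈ Attainable Q Φ s := by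
  have hs0 : 0 < s := by linarith
  have ht0 : 0 < t := by linarith
  have h0 : 0 < t ^ 2 / s ^ 2 := by positivity
  have h1 : t ^ 2 / s ^ 2 ≤ 1 := by
    rw [div_le_one (by positivity)]
    gcongr
  have hsq : Real.sqrt (1 - t ^ 2 / s ^ 2) ^ 2 = 1 - t ^ 2 / s ^ 2 :=
    Real.sq_sqrt (by linarith)
  have hlt : |Real.sqrt (1 - t ^ 2 / s ^ 2)| < 1 := by
    rw [abs_of_nonneg (Real.sqrt_nonneg _), Real.sqrt_lt' one_pos]
    linarith
  have hst : s ^ 2 * (t ^ 2 / s ^ 2) = t ^ 2 := by field_simp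
  have h := exists_step hΦ (ht.trans hts) hsQ hg hg hlt
    (β := -Real.sqrt (1 - t ^ 2 / s ^ 2)) (by rwa [abs_neg])
    (by linear_combination (-s ^ 2) * hsq + hst)
    (by linear_combination (-s ^ 2) * hsq + hst)
  convert h using 1
  rw [neg_sq, hsq, fOf]
  ring

/-- Take α = β = d/s: the pair of averages moves along its ray, and the jump estimate is again
sharp. -/
lemma attainable_mid {Q : ℝ} {Φ : ℝ → ℝ} (hΦ : ∀ t, 1 ≤ t → 0 ≤ Φ t) {s d g₁ g₂ : ℝ} (hd : 0 ≤ d)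
    (hs : 1 ≤ s - d) (hsQ : s ^ 2 ≤ Q) (h1 : g₁ ∈ Attainable Q Φ (s + d))
    (h2 : g₂ ∈ Attainable Q Φ (s - d)) :
    8 * hOf Φ s * d ^ 2 + (g₁ + g₂) / 2 ∈ Attainable Q Φ s := by
  have hs0 : 0 < s := by linarith
  have hlt : |d / s| < 1 := by
    rw [abs_of_nonneg (by positivity), div_lt_one hs0]
    linarith
  have h := exists_step hΦ (by linarith) hsQ h1 h2 hlt hlt (by field_simp) (by field_simp)
  convert h using 1
  rw [hOf, fOf]
  field_simp
  ring

/-- The content is that admissible weights exist: two constants, glued by one downward step from `s`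
to 1. -/
lemma zero_mem_attainable {Q : ℝ} {Φ : ℝ → ℝ} (hΦ : ∀ t, 1 ≤ t → 0 ≤ Φ t) {s : ℝ}
    (hs : 1 ≤ s) (hsQ : s ^ 2 ≤ Q) : 0 ∈ Attainable Q Φ s := by
  have h := attainable_down hΦ le_rfl hs hsQ
    (zero_mem_attainable_one (by nlinarith) Φ)
  exact ⟨le_rfl, fun I x₁ x₂ h1 h2 hx => by
    obtain ⟨w, hw, -⟩ := h.2 I x₁ x₂ h1 h2 hx
    exact ⟨w, hw, by simp⟩⟩

lemma le_of_mem_attainable {Q : ℝ} {Φ : ℝ → ℝ} {s g v : ℝ} (hs : 1 ≤ s) (hv : 0 ≤ v)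
    (hg : g ∈ Attainable Q Φ s)
    (hub : ∀ (I : Ivl) (w : ℝ → ℝ), w ∈ E Q (s, s) I → dyadicSum Φ w I ≤ ENNReal.ofReal v) :
    g ≤ v := by
  obtain ⟨w, hw, hle⟩ := hg.2 ⟨0, 1, one_pos⟩ s s (by linarith) (by linarith) (by ring)
  exact (ENNReal.ofReal_le_ofReal_iff hv).mp (hle.trans (hub _ w hw))

lemma le_upperBellman {Q : ℝ} {Φ : ℝ → ℝ} {s v : ℝ} {I : Ivl} {x₁ x₂ : ℝ} (h1 : 0 < x₁)
    (h2 : 0 < x₂) (hx : x₁ * x₂ = s ^ 2) (h : ∀ z < v, ∃ g ∈ Attainable Q Φ s, z ≤ g) :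
    (v : EReal) ≤ upperBellman Q Φ I (x₁, x₂) := by
  refine EReal.ge_of_forall_gt_iff_ge.mp fun z hz => ?_
  obtain ⟨g, hg, hzg⟩ := h z (by exact_mod_cast hz)
  obtain ⟨w, hw, hle⟩ := hg.2 I x₁ x₂ h1 h2 hx
  refine le_trans ?_ (le_iSup₂_of_le w hw le_rfl)
  refine le_trans ?_ (EReal.coe_ennreal_le_coe_ennreal_iff.mpr hle)
  rw [EReal.coe_ennreal_ofReal, max_eq_left hg.1]
  exact_mod_cast hzg

/-- A supersolution dominates the upper Bellman function. -/
lemma upperBellman_le {Q L : ℝ} (hQ : 0 ≤ Q) (hL : L = Real.sqrt Q) {Φ G : ℝ → ℝ}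
    (hΦ : ∀ t, 1 ≤ t → 0 ≤ Φ t) (hG0 : ∀ s ∈ Icc 1 L, 0 ≤ G s)
    (hG : ∀ s ∈ Icc 1 L, ∀ a ∈ Icc 1 L, ∀ b ∈ Icc 1 L, a + b ≤ 2 * s →
      8 * fOf Φ s * (1 - a * b / s ^ 2) + (G a + G b) / 2 ≤ G s)
    {I : Ivl} {x₁ x₂ s : ℝ} (hs : s = Real.sqrt (x₁ * x₂)) (hsL : s ∈ Icc 1 L) :
    upperBellman Q Φ I (x₁, x₂) ≤ (G s : ℝ) := by
  refine iSup₂_le fun w hw => ?_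
  have h := dyadicSum_le_of_supersolution hQ hL hΦ hG0 hG hw.1
  rw [hw.2.1, hw.2.2, ← hs] at h
  refine (EReal.coe_ennreal_le_coe_ennreal_iff.mpr h).trans ?_
  rw [EReal.coe_ennreal_ofReal, max_eq_left (hG0 s hsL)]

/-! ### The lower bound in the decreasing case -/

lemma exists_nat_div_le (K : ℝ) {ε : ℝ} (hε : 0 < ε) : ∃ n : ℕ, 0 < n ∧ K / n ≤ ε := by
  obtain ⟨n, hn⟩ := exists_nat_gt (max (K / ε) 0)
  have hn0 : (0 : ℝ) < n := (le_max_right _ _).trans_lt hn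
  refine ⟨n, by exact_mod_cast hn0, ?_⟩
  rw [div_le_iff₀ hn0]
  have := (div_lt_iff₀ hε).mp ((le_max_left _ _).trans_lt hn)
  linarith

lemma exists_attainable_canda {Q : ℝ} {Φ : ℝ → ℝ} (hΦ : ∀ t, 1 ≤ t → 0 ≤ Φ t)
    (hf : AntitoneOn (fOf Φ) (Ici 1)) {s : ℝ} (hs : 1 ≤ s) (hsQ : s ^ 2 ≤ Q) :
    ∀ z < canda (fOf Φ) s, ∃ g ∈ Attainable Q Φ s, z ≤ g := by
  intro z hz
  set f := fOf Φ with hfdef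
  have hf0 : ∀ t, 1 ≤ t → 0 ≤ f t := fun t ht => hΦ _ (one_le_pow₀ ht)
  obtain ⟨n, hn, hnz⟩ := exists_nat_div_le
    ((s - 1) * (16 * f 1 + 8 * f 1 * (s - 1))) (sub_pos.mpr hz)
  have hn0 : (0 : ℝ) < n := by exact_mod_cast hn
  obtain ⟨d, hd⟩ : ∃ d, d = (s - 1) / n := ⟨_, rfl⟩
  have hd0 : 0 ≤ d := hd ▸ div_nonneg (by linarith) hn0.le
  have hnd : n * d = s - 1 := by rw [hd]; field_simp
  -- Each downward step gains the right-endpoint value of 16f(z)/z, up to 8d²f(1). The middle term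
  -- records the telescoping gap to the left-endpoint sum, which dominates the integral.
  have main : ∀ k : ℕ, k ≤ n → ∃ g ∈ Attainable Q Φ (1 + k * d),
      canda f (1 + k * d) + 16 * d * (f (1 + k * d) / (1 + k * d) - f 1)
        - 8 * f 1 * d ^ 2 * k ≤ g := by
    intro k
    induction k with
    | zero =>
      intro _
      refine ⟨0, by simpa using zero_mem_attainable_one (by nlinarith) Φ, ?_⟩
      simp [canda]
    | succ k ih =>
      intro hk
      obtain ⟨g, hg, hle⟩ := ih (by omega)
      have hk0 : (0 : ℝ) ≤ k := Nat.cast_nonneg k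
      have ht1 : 1 ≤ 1 + k * d := by have := mul_nonneg hk0 hd0; linarith
      have hk1 : ((k + 1 : ℕ) : ℝ) ≤ n := by exact_mod_cast hk
      have htd : 1 + ((k + 1 : ℕ) : ℝ) * d = (1 + k * d) + d := by push_cast; ring
      have hts : (1 + k * d) + d ≤ s := by
        rw [← htd]
        have := mul_le_mul_of_nonneg_right hk1 hd0
        linarith
      rw [htd]
      push_cast
      generalize 1 + k * d = t at *
      have hg' := attainable_down hΦ (s := t + d) ht1 (by linarith)
        (le_trans (by gcongr) hsQ) hg
      refine ⟨_, hg', ?_⟩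
      have i1 : canda f (t + d) - canda f t = 16 * ∫ z in t..(t + d), f z / z := by
        rw [canda, canda, ← mul_sub, intervalIntegral.integral_interval_sub_left
          (intervalIntegrable_div_of_antitoneOn hf le_rfl (by linarith))
          (intervalIntegrable_div_of_antitoneOn hf le_rfl ht1)]
      have i2 : ∫ z in t..(t + d), f z / z ≤ ∫ z in t..(t + d), f t / t := by
        refine intervalIntegral.integral_mono_on (by linarith)
          (intervalIntegrable_div_of_antitoneOn hf ht1 (by linarith)) (by simp) fun z hz => ?_
        have := hf0 t ht1
        exact div_le_div₀ this (hf ht1 (ht1.trans hz.1) hz.1) (by linarith) hz.1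
      rw [intervalIntegral.integral_const, smul_eq_mul, add_sub_cancel_left] at i2
      have i3 : f (t + d) ≤ f 1 := hf (mem_Ici.2 le_rfl) (mem_Ici.2 (by linarith)) (by linarith)
      have i4 : f (t + d) / (t + d) ^ 2 ≤ f 1 :=
        (div_le_self (hf0 _ (by linarith)) (one_le_pow₀ (by linarith))).trans i3
      have i5 : 8 * f (t + d) * (1 - t ^ 2 / (t + d) ^ 2) =
          16 * d * (f (t + d) / (t + d)) - 8 * d ^ 2 * (f (t + d) / (t + d) ^ 2) := by
        have : t + d ≠ 0 := by linarith
        field_simp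
        ring
      have i6 := mul_le_mul_of_nonneg_left i4 (sq_nonneg d)
      rw [← hfdef, i5]
      linarith
  obtain ⟨g, hg, hle⟩ := main n le_rfl
  rw [hnd, add_sub_cancel] at hg hle
  refine ⟨g, hg, ?_⟩
  have h1 : 0 ≤ d * (f s / s) := mul_nonneg hd0 (div_nonneg (hf0 s hs) (by linarith))
  have h2 : (s - 1) * (16 * f 1 + 8 * f 1 * (s - 1)) / n =
      16 * d * f 1 + 8 * f 1 * d * (n * d) := by
    rw [hnd, hd]; ring
  rw [h2] at hnz
  linarith

/-! ### The lower bound in the increasing case -/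

/-- A symmetric step bounds the supremum at `t` by those at t ± d, one of which lies further up, so
no finite recursion is available. Instead the suprema satisfy a difference inequality. Their
finiteness, `hbdd`, allows terms to be moved across it, and the upper bound supplies it. -/
lemma exists_attainable_profile {Q L : ℝ} {Φ : ℝ → ℝ} (hΦ : ∀ t, 1 ≤ t → 0 ≤ Φ t)
    (hf : MonotoneOn (fOf Φ) (Ici 1)) (hi : IntervalIntegrable (hOf Φ) volume 1 L)
    (hLQ : L ^ 2 ≤ Q)
    (hbdd : ∀ t ∈ Icc 1 L, BddAbove (Attainable Q Φ t)) {s : ℝ} (hs : s ∈ Icc 1 L) :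
    ∀ z < profile L (hOf Φ) s, ∃ g ∈ Attainable Q Φ s, z ≤ g := by
  have hL1 : (1 : ℝ) ≤ L := hs.1.trans hs.2
  have hL0 : 0 < L := by linarith
  have hsq : ∀ t ∈ Icc 1 L, t ^ 2 ≤ Q := fun t ht => by
    have := ht.1
    have := ht.2
    exact le_trans (by gcongr) hLQ
  rcases hL1.eq_or_lt with hL | hL1'
  · intro z hz
    have hs1 : s = 1 := le_antisymm (hs.2.trans hL.ge) hs.1
    rw [hs1, profile_one] at hz
    exact ⟨0, zero_mem_attainable hΦ hs.1 (hsq s hs), hz.le⟩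
  set b : ℝ → ℝ := fun t => sSup (Attainable Q Φ t) with hb
  suffices hmain : profile L (hOf Φ) s ≤ b s by
    intro z hz
    obtain ⟨g, hg, hzg⟩ := exists_lt_of_lt_csSup
      ⟨0, zero_mem_attainable hΦ hs.1 (hsq s hs)⟩ (hz.trans_le hmain)
    exact ⟨g, hg, hzg.le⟩
  have hne : ∀ t ∈ Icc 1 L, (Attainable Q Φ t).Nonempty :=
    fun t ht => ⟨0, zero_mem_attainable hΦ ht.1 (hsq t ht)⟩
  have bdown : ∀ t u, 1 ≤ t → t ≤ u → u ≤ L →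
      8 * fOf Φ u * (1 - t ^ 2 / u ^ 2) + b t ≤ b u := by
    intro t u ht htu hu
    have hum : u ∈ Icc 1 L := ⟨ht.trans htu, hu⟩
    rw [← le_sub_iff_add_le']
    refine csSup_le (hne t ⟨ht, htu.trans hu⟩) fun g hg => ?_
    rw [le_sub_iff_add_le']
    exact le_csSup (hbdd u hum) (attainable_down hΦ ht htu (hsq u hum) hg)
  have bmid : ∀ t d, 0 ≤ d → 1 ≤ t - d → t + d ≤ L →
      8 * hOf Φ t * d ^ 2 + (b (t + d) + b (t - d)) / 2 ≤ b t := by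
    intro t d hd htd htd'
    have htm : t ∈ Icc 1 L := ⟨by linarith, by linarith⟩
    have h1 : b (t + d) ≤ 2 * (b t - 8 * hOf Φ t * d ^ 2) - b (t - d) := by
      refine csSup_le (hne _ ⟨by linarith, htd'⟩) fun g hg => ?_
      have h2 : b (t - d) ≤ 2 * (b t - 8 * hOf Φ t * d ^ 2) - g := by
        refine csSup_le (hne _ ⟨htd, by linarith⟩) fun g' hg' => ?_
        have := le_csSup (hbdd t htm) (attainable_mid hΦ hd htd (hsq t htm) hg hg')
        change _ ≤ b t at this
        linarith
      linarith
    linarith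
  have hf0 : ∀ t, 1 ≤ t → 0 ≤ fOf Φ t := fun t ht => hΦ _ (one_le_pow₀ ht)
  have hh0 : ∀ t, 1 ≤ t → 0 ≤ hOf Φ t := fun t ht => div_nonneg (hf0 t ht) (sq_nonneg t)
  have hLm : L ∈ Icc 1 L := ⟨hL1, le_rfl⟩
  have h1m : (1 : ℝ) ∈ Icc 1 L := ⟨le_rfl, hL1⟩
  have hK0 := hf0 L hL1
  have slope_diff : ∀ t d, 0 ≤ d → 1 ≤ t → t + d ≤ L →
      profileSlope L (hOf Φ) t - profileSlope L (hOf Φ) (t + d) ≤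
        16 * (d * (fOf Φ (t + d) / t ^ 2)) := by
    intro t d hd ht htd
    have htm : t ∈ Icc 1 L := ⟨ht, by linarith⟩
    have htm' : t + d ∈ Icc 1 L := ⟨by linarith, htd⟩
    have h1 : ∫ z in t..(t + d), hOf Φ z ≤ ∫ z in t..(t + d), fOf Φ (t + d) / t ^ 2 := by
      refine intervalIntegral.integral_mono_on (by linarith)
        (intervalIntegrable_of_mem hi htm htm') (by simp) fun z hz => ?_
      have hz1 := hz.1
      exact div_le_div₀ (hf0 _ htm'.1) (hf (ht.trans hz.1) htm'.1 hz.2) (by positivity)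
        (by gcongr)
    rw [intervalIntegral.integral_const, smul_eq_mul, add_sub_cancel_left,
      integral_sub_eq hi htm htm'] at h1
    rw [profileSlope, profileSlope, integral_sub_eq hi htm hLm, integral_sub_eq hi htm' hLm]
    linarith
  -- Increments are propagated downward from `L`, with `i` counting the steps. The downward step at
  -- `L` starts the induction. Sampling errors are at most 16d²(f(t + d) - f(t)), so they telescope
  -- and stay O(d²) however many steps are taken.
  have incr : ∀ d, 0 ≤ d → ∀ (i : ℕ) (t : ℝ), t + i * d = L → 1 ≤ t - d →
      d * profileSlope L (hOf Φ) t - 16 * d ^ 2 * (fOf Φ L - fOf Φ t) - 8 * d ^ 2 * fOf Φ L ≤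
        b t - b (t - d) := by
    intro d hd i
    induction i with
    | zero =>
      intro t ht htd
      have htL : t = L := by simpa using ht
      subst htL
      have h1 := bdown (t - d) t htd (by linarith) le_rfl
      have h2 : 8 * fOf Φ t * (1 - (t - d) ^ 2 / t ^ 2) =
          16 * d * (fOf Φ t / t) - 8 * d ^ 2 * (fOf Φ t / t ^ 2) := by
        field_simp
        ring
      have h3 : fOf Φ t / t ^ 2 ≤ fOf Φ t := div_le_self hK0 (one_le_pow₀ hL1)
      have h4 : profileSlope t (hOf Φ) t = 16 * (fOf Φ t / t) := by
        rw [profileSlope, intervalIntegral.integral_same, hOf]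
        field_simp
        ring
      have h5 := mul_le_mul_of_nonneg_left h3 (sq_nonneg d)
      rw [h4]
      linarith
    | succ i ih =>
      intro t ht htd
      push_cast at ht
      have htd' : t + d ≤ L := by
        have : 0 ≤ (i : ℝ) * d := by positivity
        linarith
      have h1 := ih (t + d) (by linarith) (by linarith)
      have h2 := bmid t d hd htd htd'
      have h3 := slope_diff t d hd (by linarith) htd'
      have ht1 : 1 ≤ t := by linarith
      have h4 : fOf Φ (t + d) / t ^ 2 ≤ hOf Φ t + (fOf Φ (t + d) - fOf Φ t) := by
        have h5 : fOf Φ t ≤ fOf Φ (t + d) :=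
          hf (mem_Ici.2 ht1) (mem_Ici.2 (by linarith)) (by linarith)
        have h6 : (fOf Φ (t + d) - fOf Φ t) / t ^ 2 ≤ fOf Φ (t + d) - fOf Φ t :=
          div_le_self (by linarith) (one_le_pow₀ ht1)
        rw [sub_div] at h6
        rw [hOf]
        linarith
      have h7 := mul_le_mul_of_nonneg_left h3 hd
      have h8 := mul_le_mul_of_nonneg_left h4 (sq_nonneg d)
      rw [add_sub_cancel_right] at h1
      linarith
  -- The constant 40 is 16 + 8 from `incr` plus 16 for comparing the profile slopes at `t` and t +
  -- d.
  have lattice : ∀ (N : ℕ) (d : ℝ), 0 ≤ d → 1 + N * d = L → ∀ k : ℕ, k ≤ N →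
      profile L (hOf Φ) (1 + k * d) - 40 * fOf Φ L * d ^ 2 * k ≤ b (1 + k * d) := by
    intro N d hd hN k
    induction k with
    | zero =>
      intro _
      have h1 : 0 ≤ b 1 := le_csSup (hbdd 1 h1m) (zero_mem_attainable hΦ le_rfl (hsq 1 h1m))
      simpa [profile_one] using h1
    | succ k ih =>
      intro hk
      have h1 := ih (by omega)
      obtain ⟨i, rfl⟩ := Nat.exists_eq_add_of_le hk
      have hi0 : (0 : ℝ) ≤ i * d := by positivity
      have ht1 : 1 ≤ 1 + (k : ℝ) * d := by
        have : (0 : ℝ) ≤ k * d := by positivity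
        linarith
      have htd : 1 + ((k + 1 : ℕ) : ℝ) * d = (1 + k * d) + d := by push_cast; ring
      push_cast at hN
      have hN' : (1 + k * d) + d + i * d = L := by linarith
      rw [htd]
      push_cast
      generalize 1 + (k : ℝ) * d = t at *
      have h2 := incr d hd i (t + d) hN' (by linarith)
      rw [add_sub_cancel_right] at h2
      have htdL : t + d ≤ L := by linarith
      have h3 := profile_sub_le hi hh0 (s := t) (t := t + d) ⟨ht1, by linarith⟩
        ⟨by linarith, htdL⟩ (by linarith)
      rw [add_sub_cancel_left] at h3
      have h4 := slope_diff t d hd ht1 htdL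
      have htdf := hf0 (t + d) (by linarith)
      have h5 : fOf Φ (t + d) / t ^ 2 ≤ fOf Φ L :=
        (div_le_self htdf (one_le_pow₀ ht1)).trans
          (hf (mem_Ici.2 (by linarith)) (mem_Ici.2 hL1) htdL)
      have h6 := mul_le_mul_of_nonneg_left h4 hd
      have h7 := mul_le_mul_of_nonneg_left h5 (sq_nonneg d)
      have h8 := mul_nonneg (sq_nonneg d) htdf
      linarith
  refine le_of_forall_pos_le_add fun ε hε => ?_
  obtain ⟨N, hN, hNε⟩ := exists_nat_div_le
    ((L - 1) * (40 * fOf Φ L * (L - 1) + profileSlope L (hOf Φ) 1)) hε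
  have hN0 : (0 : ℝ) < N := by exact_mod_cast hN
  obtain ⟨d, hd⟩ : ∃ d, d = (L - 1) / N := ⟨_, rfl⟩
  have hd0 : 0 < d := hd ▸ div_pos (by linarith) hN0
  have hNd : N * d = L - 1 := by rw [hd]; field_simp
  have hε' : d * (40 * fOf Φ L * (L - 1) + profileSlope L (hOf Φ) 1) ≤ ε := by
    rw [hd]
    refine le_of_eq_of_le ?_ hNε
    ring
  -- The lattice must contain both 1 and `L`, so it may miss `s`. The suprema increase, and the
  -- profile changes by O(d) from the lattice point below `s`.
  set k := ⌊(s - 1) / d⌋₊ with hk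
  have hk1 : k * d ≤ s - 1 :=
    (le_div_iff₀ hd0).mp (Nat.floor_le (div_nonneg (by linarith [hs.1]) hd0.le))
  have hk2 : s - 1 < (k + 1) * d := (div_lt_iff₀ hd0).mp (Nat.lt_floor_add_one _)
  have hkN : k ≤ N := by
    have h1 : (k : ℝ) * d ≤ N * d := by linarith [hs.2]
    exact_mod_cast le_of_mul_le_mul_right h1 hd0
  have h1 := lattice N d hd0.le (by linarith) k hkN
  have hkd0 : (0 : ℝ) ≤ k * d := by positivity
  have htm : 1 + (k : ℝ) * d ∈ Icc 1 L := ⟨by linarith, by linarith [hs.2]⟩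
  have h2 := bdown (1 + k * d) s htm.1 (by linarith) hs.2
  have h3 : 0 ≤ 8 * fOf Φ s * (1 - (1 + k * d) ^ 2 / s ^ 2) := by
    have hs0 : 0 < s := by linarith [hs.1]
    refine mul_nonneg (mul_nonneg (by norm_num) (hf0 s hs.1)) (sub_nonneg.mpr ?_)
    rw [div_le_one (by positivity)]
    have : 1 + k * d ≤ s := by linarith
    gcongr
  have h4 := profile_sub_le hi hh0 htm hs (by linarith)
  have h5 : profileSlope L (hOf Φ) (1 + k * d) ≤ profileSlope L (hOf Φ) 1 := by
    rw [profileSlope, profileSlope, integral_sub_eq hi htm hLm]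
    have := intervalIntegral.integral_nonneg (μ := volume) htm.1 fun z hz => hh0 z hz.1
    linarith
  have h6 : (s - (1 + k * d)) * profileSlope L (hOf Φ) (1 + k * d) ≤
      d * profileSlope L (hOf Φ) 1 :=
    mul_le_mul (by linarith) h5 (profileSlope_nonneg hh0 htm) hd0.le
  have h7 : 40 * fOf Φ L * d * (k * d) ≤ 40 * fOf Φ L * d * (L - 1) :=
    mul_le_mul_of_nonneg_left (by linarith [hs.2]) (by positivity)
  linarith

/-! ### The affine majorant in the concave case -/

/-- The profile integrates `h` against 16 times L(s - 1)δ_L + (min(z, s) - 1)dz on [1, L]; `s0` is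
the barycentre of this measure, so `q` disappears. -/
lemma profile_affine {L c q s : ℝ} (hden : 4 * L - s - 1 ≠ 0) :
    profile L (fun z => c + q * (z - s0 L s)) s = 8 * (s - 1) * (4 * L - s - 1) * c := by
  have h1 : ∫ z in (1 : ℝ)..s, (c + q * (z - s0 L s)) * (s - z) =
      -∫ z in (1 : ℝ)..s, (c + q * (z - s0 L s)) * (z - s) := by
    rw [← intervalIntegral.integral_neg]
    congr 1
    ext z
    ring
  have h2 : s0 L s * (3 * (4 * L - s - 1)) = 9 * L ^ 2 - s ^ 2 - s - 1 :=
    div_mul_cancel₀ _ (mul_ne_zero three_ne_zero hden)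
  rw [profile, h1, integral_affine, integral_affine_mul]
  generalize s0 L s = t at *
  linear_combination -(8 / 3) * q * (s - 1) * h2

lemma one_lt_s0 {L s : ℝ} (hL : 1 < L) (hs : s ∈ Icc 1 L) : 1 < s0 L s := by
  have h1 := hs.1
  have h2 := hs.2
  rw [s0, lt_div_iff₀ (by linarith)]
  nlinarith [mul_nonneg (sub_nonneg.mpr h2) (by linarith : 0 ≤ L + s - 2)]

lemma exists_affine_majorant {h : ℝ → ℝ} (h0 : ∀ z, 1 ≤ z → 0 ≤ h z)
    (hh : ConcaveOn ℝ (Ici 1) h) {t : ℝ} (ht : 1 < t) :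
    ∃ q : ℝ, 0 ≤ q ∧ ∀ z, 1 ≤ z → h z ≤ h t + q * (z - t) := by
  obtain ⟨p, hp⟩ := exists_supporting_slope hh.neg ht
  simp only [Pi.neg_apply] at hp
  refine ⟨-p, ?_, fun z hz => by linarith [hp z hz]⟩
  by_contra hneg
  have hp0 : 0 < p := by linarith
  -- At this point a majorant of slope -p would equal -1, contradicting h ≥ 0.
  have hz1 : 1 ≤ t + (h t + 1) / p := by
    have := h0 t ht.le
    have : 0 ≤ (h t + 1) / p := by positivity
    linarith
  have h1 := hp _ hz1
  have h2 := h0 _ hz1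
  rw [add_sub_cancel_left, mul_div_cancel₀ _ hp0.ne'] at h1
  linarith

end

end DyadicBellman

/-! ### The main theorem: assembling the three cases. -/

open DyadicBellman in
theorem theorem2p10 (Q : ℝ) (hQ : 1 ≤ Q) (Φ : ℝ → ℝ) (hΦ : ∀ t, 1 ≤ t → 0 ≤ Φ t)
    (L : ℝ) (hL : L = Real.sqrt Q)
    (I : DyadicBellman.Ivl) (x₁ x₂ : ℝ) (hx : (x₁, x₂) ∈ DyadicBellman.Omega Q)
    (s : ℝ) (hs : s = Real.sqrt (x₁ * x₂)) :
    (DyadicBellman.E Q (x₁, x₂) I).Nonempty ∧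
    (MonotoneOn Φ (Set.Ici 1) → ConvexOn ℝ (Set.Ici 1) (DyadicBellman.hOf Φ) →
      IntervalIntegrable (fun z => DyadicBellman.fOf Φ z / z ^ 2) MeasureTheory.volume 1 L ∧
      IntervalIntegrable (fun z => DyadicBellman.fOf Φ z / z ^ 2 * (s - z))
        MeasureTheory.volume 1 s ∧
      DyadicBellman.upperBellman Q Φ I (x₁, x₂)
        = ((DyadicBellman.candA L (DyadicBellman.fOf Φ) s : ℝ) : EReal)) ∧
    (MonotoneOn Φ (Set.Ici 1) → ConcaveOn ℝ (Set.Ici 1) (DyadicBellman.hOf Φ) →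
      DyadicBellman.upperBellman Q Φ I (x₁, x₂)
        ≤ ((8 * (s - 1) * (4 * L - s - 1) * DyadicBellman.hOf Φ (DyadicBellman.s0 L s) : ℝ)
            : EReal)) ∧
    (AntitoneOn Φ (Set.Ici 1) →
      IntervalIntegrable (fun z => DyadicBellman.fOf Φ z / z) MeasureTheory.volume 1 s ∧
      DyadicBellman.upperBellman Q Φ I (x₁, x₂)
        = ((DyadicBellman.canda (DyadicBellman.fOf Φ) s : ℝ) : EReal)) := by
  obtain ⟨hx₁, hx₂, hx1, hxQ⟩ := hx
  simp only at hx₁ hx₂ hx1 hxQ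
  have hQ0 : 0 ≤ Q := by linarith
  have hss : x₁ * x₂ = s ^ 2 := by rw [hs, Real.sq_sqrt (by linarith)]
  have hsL : s ∈ Set.Icc 1 L :=
    ⟨hs ▸ Real.one_le_sqrt.mpr hx1, hs ▸ hL ▸ Real.sqrt_le_sqrt hxQ⟩
  have hL1 : 1 ≤ L := hsL.1.trans hsL.2
  have hLQ : L ^ 2 ≤ Q := by rw [hL, Real.sq_sqrt hQ0]
  have hsQ : s ^ 2 ≤ Q := hss ▸ hxQ
  have hf0 : ∀ t, 1 ≤ t → 0 ≤ fOf Φ t := fun t ht => hΦ _ (one_le_pow₀ ht)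
  have hh0 : ∀ t, 1 ≤ t → 0 ≤ hOf Φ t := fun t ht => div_nonneg (hf0 t ht) (sq_nonneg t)
  have hsqm : MonotoneOn (fun z : ℝ => z ^ 2) (Set.Ici 1) := fun u hu v hv huv => by
    have : (1 : ℝ) ≤ u := hu
    simp only
    gcongr
  have hmaps : Set.MapsTo (fun z : ℝ => z ^ 2) (Set.Ici 1) (Set.Ici 1) :=
    fun z hz => one_le_pow₀ (Set.mem_Ici.1 hz)
  refine ⟨?_, fun hmono hconv => ?_, fun hmono hconc => ?_, fun hanti => ?_⟩
  · obtain ⟨w, hw, -⟩ := (zero_mem_attainable hΦ hsL.1 hsQ).2 I x₁ x₂ hx₁ hx₂ hss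
    exact ⟨w, hw⟩
  · have hf : MonotoneOn (fOf Φ) (Set.Ici 1) := hmono.comp hsqm hmaps
    have hi : IntervalIntegrable (hOf Φ) MeasureTheory.volume 1 L := by
      have hsub : Set.uIcc 1 L ⊆ Set.Ici 1 := by
        rw [Set.uIcc_of_le hL1]
        exact Set.Icc_subset_Ici_self
      refine ((hf.mono hsub).intervalIntegrable).mul_continuousOn
        (ContinuousOn.inv₀ (by fun_prop) fun z hz => ?_)
      have : (1 : ℝ) ≤ z := hsub hz
      positivity
    have hm : MonotoneOn (fun z => z ^ 2 * hOf Φ z) (Set.Ici 1) := by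
      refine hf.congr fun z hz => ?_
      have : (1 : ℝ) ≤ z := hz
      rw [hOf]
      field_simp
    have hcand : candA L (fOf Φ) s = profile L (hOf Φ) s := by
      have e1 : fOf Φ L / L = L * hOf Φ L := by
        rw [hOf]
        field_simp
      rw [candA, profile, e1]
      rfl
    have hsup : ∀ s ∈ Set.Icc 1 L, ∀ a ∈ Set.Icc 1 L, ∀ b ∈ Set.Icc 1 L, a + b ≤ 2 * s →
        8 * fOf Φ s * (1 - a * b / s ^ 2) + (profile L (hOf Φ) a + profile L (hOf Φ) b) / 2 ≤
          profile L (hOf Φ) s := by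
      intro s hs a ha b hb hab
      have h1 := profile_supersolution hi hh0 hconv hm hs ha hb hab
      have h2 : 8 * fOf Φ s * (1 - a * b / s ^ 2) = 8 * hOf Φ s * (s ^ 2 - a * b) := by
        have : (1 : ℝ) ≤ s := hs.1
        rw [hOf]
        field_simp
      rwa [h2]
    have hG0 : ∀ t ∈ Set.Icc 1 L, 0 ≤ profile L (hOf Φ) t := fun t ht => profile_nonneg hi hh0 ht
    refine ⟨hi, (intervalIntegrable_of_mem hi ⟨le_rfl, hL1⟩ hsL).mul_continuousOn
      (by fun_prop), ?_⟩
    rw [hcand]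
    refine le_antisymm (upperBellman_le hQ0 hL hΦ hG0 hsup hs hsL)
      (le_upperBellman hx₁ hx₂ hss
        (exists_attainable_profile hΦ hf hi hLQ (fun t ht => ?_) hsL))
    refine ⟨profile L (hOf Φ) t, fun g hg => ?_⟩
    refine le_of_mem_attainable ht.1 (hG0 t ht) hg fun J w hw => ?_
    have h := dyadicSum_le_of_supersolution hQ0 hL hΦ hG0 hsup hw.1
    rwa [hw.2.1, hw.2.2, Real.sqrt_mul_self (by linarith [ht.1])] at h
  · rcases hL1.eq_or_lt with hL1' | hL1'
    · have hs1 : s = 1 := le_antisymm (hsL.2.trans hL1'.ge) hsL.1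
      have h := upperBellman_le (I := I) (G := fun _ => 0) hQ0 hL hΦ (by simp)
        (fun t ht a ha b hb _ => ?_) hs hsL
      · simpa [hs1] using h
      · have e1 : t = 1 := le_antisymm (ht.2.trans hL1'.ge) ht.1
        have e2 : a = 1 := le_antisymm (ha.2.trans hL1'.ge) ha.1
        have e3 : b = 1 := le_antisymm (hb.2.trans hL1'.ge) hb.1
        simp [e1, e2, e3]
    · obtain ⟨q, hq, hmaj⟩ := exists_affine_majorant hh0 hconc (one_lt_s0 hL1' hsL)
      set l : ℝ → ℝ := fun z => hOf Φ (s0 L s) + q * (z - s0 L s) with hl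
      have hl0 : ∀ z, 1 ≤ z → 0 ≤ l z := fun z hz => (hh0 z hz).trans (hmaj z hz)
      have hlm : MonotoneOn l (Set.Ici 1) := fun u _ v _ huv => by
        simp only [hl]
        gcongr
      have hi : IntervalIntegrable l MeasureTheory.volume 1 L :=
        Continuous.intervalIntegrable (by fun_prop) _ _
      have hconv : ConvexOn ℝ (Set.Ici 1) l := by
        refine ⟨convex_Ici 1, fun x _ y _ a b _ _ hab => le_of_eq ?_⟩
        simp only [hl, smul_eq_mul]
        linear_combination (q * s0 L s - hOf Φ (s0 L s)) * hab
      have hm : MonotoneOn (fun z => z ^ 2 * l z) (Set.Ici 1) :=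
        hsqm.mul hlm (fun z _ => sq_nonneg z) hl0
      have h := upperBellman_le (I := I) (G := profile L l) hQ0 hL hΦ
        (fun t ht => profile_nonneg hi hl0 ht) (fun t ht a ha b hb hab => ?_) hs hsL
      · rwa [profile_affine (by linarith [hsL.2])] at h
      -- The supersolution inequality for the majorant implies the one for `h`, because s² - ab ≥ 0
      -- when a + b ≤ 2s.
      · refine le_trans ?_ (profile_supersolution hi hl0 hconv hm ht ha hb hab)
        have ht1 := ht.1
        have ha1 := ha.1
        have hb1 := hb.1
        have h2 : 8 * fOf Φ t * (1 - a * b / t ^ 2) = 8 * hOf Φ t * (t ^ 2 - a * b) := by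
          rw [hOf]
          field_simp
        have h3 : 0 ≤ t ^ 2 - a * b := by nlinarith [sq_nonneg (a - b)]
        have h4 := mul_le_mul_of_nonneg_right (hmaj t ht1) h3
        rw [h2]
        linarith
  · have hf : AntitoneOn (fOf Φ) (Set.Ici 1) := fun u hu v hv huv =>
      hanti (hmaps hu) (hmaps hv) (hsqm hu hv huv)
    refine ⟨intervalIntegrable_div_of_antitoneOn hf le_rfl hsL.1, le_antisymm
      (upperBellman_le hQ0 hL hΦ (fun t ht => canda_nonneg hf0 ht.1)
        (fun t ht a ha b hb _ => canda_supersolution hf0 hf ht.1 ha.1 hb.1) hs hsL)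
      (le_upperBellman hx₁ hx₂ hss (exists_attainable_canda hΦ hf hsL.1 hsQ))⟩
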